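/- **Regret bound for VI-ULCB.** *Setting.* A tabular episodic two-player zero-sum Markov game has horizon $H$, finite state sets $\mathcal S_1,\dots,\mathcal S_{H+1}$ with $|\mathcal S_h|\le S$, finite non-empty action sets $\mathcal A_h,\mathcal B_h$ ($h\in[H]$) of the max-player and the min-player with $A_h=|\mathcal A_h|\le A$ and $B_h=|\mathcal B_h|\le B$, transition distributions $\mathbb P_h(\cdot\mid s,a,b)$ on $\mathcal S_{h+1}$ and deterministic rewards $r_h(s,a,b)\in[0,1]$. In each episode an adversary, who may use the past episodes, picks the initial state $s_1$; at each step $h\in[H]$ the players observe $s_h$, draw $a_h\sim\mu_h(\cdot\mid s_h)$ and $b_h\sim\nu_h(\cdot\mid s_h)$ independently according to their policies $\mu,\nu$, receive $r_h(s_h,a_h,b_h)$, and the next state is $s_{h+1}\sim\mathbb P_h(\cdot\mid s_h,a_h,b_h)$. Let $V_1^{\mu,\nu}(s)$ be the expected sum of the rewards of an episode that starts in $s_1=s$, and put $V_1^{\dagger,\nu}(s)=\sup_\mu V_1^{\mu,\nu}(s)$ and $V_1^{\mu,\dagger}(s)=\inf_\nu V_1^{\mu,\nu}(s)$. *Algorithm.*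 VI-ULCB plays $K$ episodes and keeps, over all past episodes, the counts $N_h(s,a,b)$ and $N_h(s,a,b,s')$ of visits and of transitions, the estimates $\hat{\mathbb P}_h(s'\mid s,a,b)=N_h(s,a,b,s')/N_h(s,a,b)$ and the last observed reward $\hat r_h(s,a,b)$. Before each episode, starting from $V^{\rm up}_{H+1}=V^{\rm low}_{H+1}=0$, for $h=H,H-1,\dots,1$ it sets, with $t=N_h(s,a,b)$, $$Q_h^{\rm up}(s,a,b)=\min\{\hat r_h(s,a,b)+[\hat{\mathbb P}_hV_{h+1}^{\rm up}](s,a,b)+\beta_t,\,H\},\qquad Q_h^{\rm low}(s,a,b)=\max\{\hat r_h(s,a,b)+[\hat{\mathbb P}_hV_{h+1}^{\rm low}](s,a,b)-\beta_t,\,0\}$$ if $t>0$, and $Q_h^{\rm up}=H$, $Q_h^{\rm low}=0$ if $t=0$. For each $s\in\mathcal S_h$ a subroutine returns a Nash equilibrium $(\phi,\psi)=(\mu_h(\cdot\mid s),\nu_h(\cdot\mid s))$ of the general-sum matrix game with payoff matrices $P=Q_h^{\rm up}(s,\cdot,\cdot)$ and $Q=Q_h^{\rm low}(s,\cdot,\cdot)$,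 that is, $\phi^\top P\psi=\max_{\tilde\phi}\tilde\phi^\top P\psi$ and $\phi^\top Q\psi=\min_{\tilde\psi}\phi^\top Q\tilde\psi$, and $V_h^{\rm up}(s)=\phi^\top P\psi$, $V_h^{\rm low}(s)=\phi^\top Q\psi$. It then plays the episode with $(\mu,\nu)$. Write $(\mu^k,\nu^k)$ and $s_1^k$ for the policies and the initial state of episode $k$, and $$\mathrm{Regret}(K)=\sum_{k=1}^K\left[V_1^{\dagger,\nu^k}(s_1^k)-V_1^{\mu^k,\dagger}(s_1^k)\right].$$ *Theorem.* There is an absolute constant $c_0>0$ such that for every $c\ge c_0$ there is a constant $C>0$, depending only on $c$, with the following property. For every game as above, every $K$, every adversary, every choice of Nash equilibria by the subroutine and every $p\in(0,1)$, let $T=KH$, $\iota=\log(SABT/p)$ and $\beta_t=c\sqrt{H^2S\iota/t}$. Then, with probability at least $1-p$, VI-ULCB satisfies $$\mathrm{Regret}(K)\le C\sqrt{H^3S^2\left[\max_{h\in[H]}A_hB_h\right]T\iota}\le C\sqrt{H^3S^2AB\,T\iota}.$$ -/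

import Mathlib

/-!
Tabular episodic two-player zero-sum Markov games and value iteration with upper and lower
confidence bounds (VI-ULCB).

Steps are numbered from `0`: an episode with horizon `H` visits states `s_0, …, s_H`, and actions
are taken at the steps `h = 0, …, H - 1`.  The families of states and actions are indexed by all
natural numbers for convenience; only `S 0, …, S H`, `A 0, …, A (H - 1)`, `B 0, …, B (H - 1)`
play a role in a game with horizon `H`.
-/

noncomputable section

namespace ZeroSumMG

universe u v w

/-- A zero-sum Markov game with state spaces `S h`, action sets `A h` of the max-player and `B h`
of the min-player: transition distributions and deterministic rewards in `[0, 1]`. -/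
structure MarkovGame (S : ℕ → Type u) (A : ℕ → Type v) (B : ℕ → Type w) where
  /-- `trans h s a b` is the distribution of the state at step `h + 1`. -/
  trans : ∀ h, S h → A h → B h → PMF (S (h + 1))
  /-- The reward received at step `h`. -/
  reward : ∀ h, S h → A h → B h → ℝ
  reward_mem : ∀ h s a b, reward h s a b ∈ Set.Icc (0 : ℝ) 1

/-- A (Markov) policy of a player with action sets `A h`: one distribution over `A h` for every
step `h` and every state in `S h`. -/
abbrev Policy (S : ℕ → Type u) (A : ℕ → Type v) := ∀ h, S h → PMF (A h)

/-- What happens in `n` consecutive steps from step `h` on, after the state at step `h`: the two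
actions and the next state, then the remaining `n - 1` steps. -/
inductive Traj (S : ℕ → Type u) (A : ℕ → Type v) (B : ℕ → Type w) : ℕ → ℕ → Type (max u v w)
  | nil (h : ℕ) : Traj S A B 0 h
  | cons {n h : ℕ} (a : A h) (b : B h) (s' : S (h + 1)) (τ : Traj S A B n (h + 1)) :
      Traj S A B (n + 1) h

/-- The only trajectory without steps. -/
def Traj.zeroEquiv (S : ℕ → Type u) (A : ℕ → Type v) (B : ℕ → Type w) (h : ℕ) :
    Unit ≃ Traj S A B 0 h where
  toFun _ := Traj.nil h
  invFun _ := ()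
  left_inv _ := rfl
  right_inv := by rintro ⟨⟩; rfl

/-- A trajectory with `n + 1` steps is a first step and a trajectory with `n` steps. -/
def Traj.succEquiv (S : ℕ → Type u) (A : ℕ → Type v) (B : ℕ → Type w) (n h : ℕ) :
    A h × B h × S (h + 1) × Traj S A B n (h + 1) ≃ Traj S A B (n + 1) h where
  toFun x := Traj.cons x.1 x.2.1 x.2.2.1 x.2.2.2
  invFun
    | Traj.cons a b s' τ => (a, b, s', τ)
  left_inv _ := rfl
  right_inv := by rintro ⟨⟩; rfl

/-- There are finitely many trajectories. -/
instance Traj.instFintype (S : ℕ → Type u) (A : ℕ → Type v) (B : ℕ → Type w)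
    [∀ h, Fintype (S h)] [∀ h, Fintype (A h)] [∀ h, Fintype (B h)] :
    ∀ n h, Fintype (Traj S A B n h)
  | 0, h => Fintype.ofEquiv Unit (Traj.zeroEquiv S A B h)
  | n + 1, h =>
    haveI := Traj.instFintype S A B n (h + 1)
    Fintype.ofEquiv _ (Traj.succEquiv S A B n h)

/-- An episode with horizon `H`: its initial state and the `H` steps that follow. -/
abbrev Episode (S : ℕ → Type u) (A : ℕ → Type v) (B : ℕ → Type w) (H : ℕ) :=
  S 0 × Traj S A B H 0

/-- Past episodes, the most recent one first. -/
abbrev History (S : ℕ → Type u) (A : ℕ → Type v) (B : ℕ → Type w) (H : ℕ) :=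
  List (Episode S A B H)

section

variable {S : ℕ → Type u} {A : ℕ → Type v} {B : ℕ → Type w}

/-! ### Playing the game, values, best responses -/

/-- The law of the next `n` steps when the players use `μ` and `ν`, from state `s` at step `h`: the
two players draw their actions independently, then the next state is drawn. -/
def rollout (G : MarkovGame S A B) (μ : Policy S A) (ν : Policy S B) :
    ∀ n h, S h → PMF (Traj S A B n h)
  | 0, h, _ => PMF.pure (Traj.nil h)
  | n + 1, h, s =>
    (μ h s).bind fun a => (ν h s).bind fun b => (G.trans h s a b).bind fun s' =>
      (rollout G μ ν n (h + 1) s').map fun τ => Traj.cons a b s' τ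

/-- The sum of the rewards along a trajectory that starts in state `s` at step `h`. -/
def cumReward (G : MarkovGame S A B) : ∀ n h, S h → Traj S A B n h → ℝ
  | 0, _, _, _ => 0
  | n + 1, h, s, Traj.cons a b s' τ => G.reward h s a b + cumReward G n (h + 1) s' τ

variable [∀ h, Fintype (S h)] [∀ h, Fintype (A h)] [∀ h, Fintype (B h)]

/-- The value of `(μ, ν)` from state `s` at step `h` when `n` steps remain: the expected sum of the
rewards of these `n` steps. With horizon `H`, the value function at step `h` is
`value G μ ν (H - h) h`; in particular that of the first step is `value G μ ν H 0`. -/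
def value (G : MarkovGame S A B) (μ : Policy S A) (ν : Policy S B) (n h : ℕ) (s : S h) : ℝ :=
  ∑ τ : Traj S A B n h, (rollout G μ ν n h s τ).toReal * cumReward G n h s τ

/-- The value of `μ` against a best response of the min-player. -/
def valueVsBestMin (G : MarkovGame S A B) (μ : Policy S A) (n h : ℕ) (s : S h) : ℝ :=
  ⨅ ν : Policy S B, value G μ ν n h s

/-- The value of `ν` against a best response of the max-player. -/
def valueVsBestMax (G : MarkovGame S A B) (ν : Policy S B) (n h : ℕ) (s : S h) : ℝ :=
  ⨆ μ : Policy S A, value G μ ν n h s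

/-! ### General-sum matrix games -/

/-- The expected payoff `φᵀ M ψ`. -/
def payoff {X Y : Type*} [Fintype X] [Fintype Y] (M : X → Y → ℝ) (φ : PMF X) (ψ : PMF Y) : ℝ :=
  ∑ a, ∑ b, (φ a).toReal * (ψ b).toReal * M a b

/-- `(φ, ψ)` is a Nash equilibrium of the game in which the row player maximizes `φᵀ P ψ` and the
column player minimizes `φᵀ Q ψ`. -/
def IsNash {X Y : Type*} [Fintype X] [Fintype Y] (P Q : X → Y → ℝ) (φ : PMF X) (ψ : PMF Y) :
    Prop :=
  (∀ φ' : PMF X, payoff P φ' ψ ≤ payoff P φ ψ) ∧ ∀ ψ' : PMF Y, payoff Q φ ψ ≤ payoff Q φ ψ'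

/-- The answers of a subroutine for general-sum games when it is called at step `h` in state `s`
with the payoff matrices `P` and `Q`. -/
abbrev Solver (S : ℕ → Type u) (A : ℕ → Type v) (B : ℕ → Type w) :=
  ∀ h, S h → (A h → B h → ℝ) → (A h → B h → ℝ) → PMF (A h) × PMF (B h)

/-- The subroutine always returns a Nash equilibrium. -/
def Solver.IsCorrect (nash : Solver S A B) : Prop :=
  ∀ h s (P Q : A h → B h → ℝ), IsNash P Q (nash h s P Q).1 (nash h s P Q).2

/-! ### VI-ULCB -/

/-- The tables that the algorithm maintains. -/
structure Tables (S : ℕ → Type u) (A : ℕ → Type v) (B : ℕ → Type w) where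
  /-- `N_h(s, a, b)`: number of visits. -/
  visits : ∀ h, S h → A h → B h → ℕ
  /-- `N_h(s, a, b, s')`: number of observed transitions. -/
  moves : ∀ h, S h → A h → B h → S (h + 1) → ℕ
  /-- The reward estimate `r̂_h(s, a, b)`; it is only read when `N_h(s, a, b) > 0`. -/
  rhat : ∀ h, S h → A h → B h → ℝ

/-- The tables before the first episode. -/
def Tables.init : Tables S A B where
  visits _ _ _ _ := 0
  moves _ _ _ _ _ := 0
  rhat _ _ _ _ := 0

/-- The empirical transition probability `N_h(s, a, b, s') / N_h(s, a, b)`. -/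
def Tables.phat (D : Tables S A B) (h : ℕ) (s : S h) (a : A h) (b : B h) (s' : S (h + 1)) : ℝ :=
  (D.moves h s a b s' : ℝ) / (D.visits h s a b : ℝ)

open Classical in
/-- The update of the tables after `(s, a, b)` was played at step `h`, the reward `r` was received
and the next state `s'` was observed. -/
def Tables.record (D : Tables S A B) (h : ℕ) (s : S h) (a : A h) (b : B h) (r : ℝ)
    (s' : S (h + 1)) : Tables S A B where
  visits i x y z :=
    if (⟨i, x, y, z⟩ : Σ i, S i × A i × B i) = ⟨h, s, a, b⟩ then D.visits i x y z + 1
    else D.visits i x y z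
  moves i x y z x' :=
    if (⟨i, x, y, z, x'⟩ : Σ i, S i × A i × B i × S (i + 1)) = ⟨h, s, a, b, s'⟩ then
      D.moves i x y z x' + 1
    else D.moves i x y z x'
  rhat i x y z :=
    if (⟨i, x, y, z⟩ : Σ i, S i × A i × B i) = ⟨h, s, a, b⟩ then r else D.rhat i x y z

/-- The updates along a trajectory that starts in state `s` at step `h`, one step after another. -/
def Tables.recordTraj (G : MarkovGame S A B) :
    ∀ n h, S h → Traj S A B n h → Tables S A B → Tables S A B
  | 0, _, _, _, D => D
  | n + 1, h, s, Traj.cons a b s' τ, D =>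
    Tables.recordTraj G n (h + 1) s' τ (D.record h s a b (G.reward h s a b) s')

/-- The tables after the episodes in a history. -/
def tables (G : MarkovGame S A B) {H : ℕ} : History S A B H → Tables S A B
  | [] => Tables.init
  | e :: hist => Tables.recordTraj G H 0 e.1 e.2 (tables G hist)

/-- The upper estimate of `Q` at step `h`, given the upper estimate `V` at step `h + 1`. -/
def qUp (H : ℕ) (β : ℕ → ℝ) (D : Tables S A B) (h : ℕ) (V : S (h + 1) → ℝ)
    (s : S h) (a : A h) (b : B h) : ℝ :=
  if D.visits h s a b = 0 then (H : ℝ)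
  else min (D.rhat h s a b + ∑ s', D.phat h s a b s' * V s' + β (D.visits h s a b)) H

/-- The lower estimate of `Q` at step `h`, given the lower estimate `V` at step `h + 1`. -/
def qLow (β : ℕ → ℝ) (D : Tables S A B) (h : ℕ) (V : S (h + 1) → ℝ)
    (s : S h) (a : A h) (b : B h) : ℝ :=
  if D.visits h s a b = 0 then 0
  else max (D.rhat h s a b + ∑ s', D.phat h s a b s' * V s' - β (D.visits h s a b)) 0

/-- One backward step of the algorithm: the strategies at step `h` in state `s`, given the upper and
lower estimates `V = (V_up, V_low)` at step `h + 1`. -/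
def nashStep (H : ℕ) (β : ℕ → ℝ) (nash : Solver S A B) (D : Tables S A B) (h : ℕ)
    (V : (S (h + 1) → ℝ) × (S (h + 1) → ℝ)) (s : S h) : PMF (A h) × PMF (B h) :=
  nash h s (qUp H β D h V.1 s) (qLow β D h V.2 s)

/-- The estimates `(V_up, V_low)` at step `h` when `n` steps remain. -/
def vEst (H : ℕ) (β : ℕ → ℝ) (nash : Solver S A B) (D : Tables S A B) :
    ∀ (_n h : ℕ), (S h → ℝ) × (S h → ℝ)
  | 0, _ => (fun _ => 0, fun _ => 0)
  | n + 1, h =>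
    let V := vEst H β nash D n (h + 1)
    let π := nashStep H β nash D h V
    (fun s => payoff (qUp H β D h V.1 s) (π s).1 (π s).2,
     fun s => payoff (qLow β D h V.2 s) (π s).1 (π s).2)

/-- The pair of strategies that the algorithm computes from its tables for step `h < H` and state
`s`. -/
def plan (H : ℕ) (β : ℕ → ℝ) (nash : Solver S A B) (D : Tables S A B) (h : ℕ) (s : S h) :
    PMF (A h) × PMF (B h) :=
  nashStep H β nash D h (vEst H β nash D (H - (h + 1)) (h + 1)) s

/-- The policy of the max-player in the episode after the history `hist`. The answers of the
subroutine may differ from episode to episode. -/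
def maxPolicy (G : MarkovGame S A B) {H : ℕ} (β : ℕ → ℝ) (nash : History S A B H → Solver S A B)
    (hist : History S A B H) : Policy S A :=
  fun h s => (plan H β (nash hist) (tables G hist) h s).1

/-- The policy of the min-player in the episode after the history `hist`. -/
def minPolicy (G : MarkovGame S A B) {H : ℕ} (β : ℕ → ℝ) (nash : History S A B H → Solver S A B)
    (hist : History S A B H) : Policy S B :=
  fun h s => (plan H β (nash hist) (tables G hist) h s).2

/-- The law of the first `k` episodes of VI-ULCB. An adversary, who knows the past episodes, picks
(possibly at random) the initial state of every episode. -/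
def historyLaw (G : MarkovGame S A B) {H : ℕ} (β : ℕ → ℝ) (nash : History S A B H → Solver S A B)
    (adv : History S A B H → PMF (S 0)) : ℕ → PMF (History S A B H)
  | 0 => PMF.pure []
  | k + 1 =>
    (historyLaw G β nash adv k).bind fun hist => (adv hist).bind fun s =>
      (rollout G (maxPolicy G β nash hist) (minPolicy G β nash hist) H 0 s).map fun τ =>
        (s, τ) :: hist

/-- The regret of VI-ULCB over the episodes in a history: the sum over the episodes of the gap
between the value of the deployed `ν` against its best response and the value of the deployed `μ`
against its best response, at the initial state of the episode. -/
def regret (G : MarkovGame S A B) {H : ℕ} (β : ℕ → ℝ) (nash : History S A B H → Solver S A B) :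
    History S A B H → ℝ
  | [] => 0
  | e :: hist =>
    regret G β nash hist +
      (valueVsBestMax G (minPolicy G β nash hist) H 0 e.1 -
        valueVsBestMin G (maxPolicy G β nash hist) H 0 e.1)

end

/-- `ι = log (S A B T / p)`, with `T = K H`, for bounds `nS`, `nA`, `nB` on the numbers of states
and actions. -/
def logFactor (nS nA nB K H : ℕ) (p : ℝ) : ℝ :=
  Real.log ((nS : ℝ) * nA * nB * (K * H) / p)

/-- The bonus `β_t = c √(H² S ι / t)`. -/
def bonus (c : ℝ) (H nS : ℕ) (ι : ℝ) (t : ℕ) : ℝ :=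
  c * Real.sqrt ((H : ℝ) ^ 2 * nS * ι / t)

/-- `max_h |A_h| |B_h|` over the steps `h < H`. -/
def maxActionPairs (A : ℕ → Type v) (B : ℕ → Type w) [∀ h, Fintype (A h)] [∀ h, Fintype (B h)]
    (H : ℕ) : ℕ :=
  (Finset.range H).sup fun h => Fintype.card (A h) * Fintype.card (B h)

end ZeroSumMG

end

/-! The proof combines optimism with a potential argument. Call the tables accurate if, at every
visited `(s, a, b)` and for every set `U` of successors, the empirical probability of `U` exceeds
the true one by at most `6 √(nS ι) / √N`. Uniformity in `U` controls total variation, hence the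
error in the mean of any function with values in `[0, H]`, in particular of the estimates `V`, which
depend on the same data. Accuracy comes from the exponential supermartingale `exp (λ · deviation -
λ² N)` (`expect_weight_tables_le`) and a union bound over steps, triples, sets `U`, values of `N`
and episodes (`toOuterMeasure_not_accurate_le`, `union_bound_le`).

For accurate tables the bonus absorbs the estimation error. Since the deployed pair is an
equilibrium for `(Q_up, Q_low)`, no opponent of `ν` gets more than `V_up` and no opponent of `μ`
pushes the value below `V_low` (`value_le_vEst_fst`, `vEst_snd_le_value`). So the regret of an
episode is at most `V_up - V_low`; the equilibrium of the true game never enters. Both estimates are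
payoffs of the same deployed pair, so their gap obeys a Bellman recursion along its play: it is at
most `H` times the value of that pair in an auxiliary game with the same transitions and reward `min
1 (l / √(N + 1))`, `l = 6 c √(nS ι)` (`vEst_fst_sub_snd_le`).

Up to a martingale of size `H √(K ι)` (`noise_concentration`), the sum of these values is the reward
actually collected for exploring. That reward is paid for by the growth of the potential `∑ 2 √N`
(`cumReward_exploreGame_le`), which Cauchy-Schwarz bounds by `2 H √(nS M K)` with `M = max |A_h|
|B_h|` (`potential_tables_le`). Multiplying by `H l` gives the order `H² nS √(M K ι)`, which is the
claim.

The argument needs `ι ≥ log 2` and `ι ≤ K`. If `ι > K`, the trivial bound `K H` suffices; if `S A B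
T < 2`, the regret is at most zero. -/

namespace ZeroSumMG

universe u v w

open scoped ENNReal

/-! ### Expectations under probability mass functions -/

/-- The expectation of a nonnegative function under a probability mass function. -/
noncomputable def expect {α : Type*} (q : PMF α) (f : α → ℝ≥0∞) : ℝ≥0∞ := ∑' a, q a * f a

section Expect

variable {α β : Type*}

theorem expect_pure (a : α) (f : α → ℝ≥0∞) : expect (PMF.pure a) f = f a := by
  rw [expect, tsum_eq_single a]
  · simp
  · intro b hb
    simp [PMF.pure_apply, hb]

theorem expect_bind (q : PMF α) (g : α → PMF β) (f : β → ℝ≥0∞) :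
    expect (q.bind g) f = expect q fun a => expect (g a) f := by
  simp only [expect, PMF.bind_apply, ← ENNReal.tsum_mul_right, ← ENNReal.tsum_mul_left]
  rw [ENNReal.tsum_comm]
  simp only [mul_assoc]

theorem expect_map (q : PMF α) (g : α → β) (f : β → ℝ≥0∞) :
    expect (q.map g) f = expect q fun a => f (g a) := by
  rw [← PMF.bind_pure_comp, expect_bind]
  simp [expect_pure]

theorem expect_mono_support (q : PMF α) {f g : α → ℝ≥0∞} (h : ∀ a, q a ≠ 0 → f a ≤ g a) :
    expect q f ≤ expect q g := by
  refine ENNReal.tsum_le_tsum fun a => ?_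
  by_cases ha : q a = 0
  · simp [ha]
  · exact mul_le_mul_right (h a ha) _

theorem expect_mono (q : PMF α) {f g : α → ℝ≥0∞} (h : ∀ a, f a ≤ g a) :
    expect q f ≤ expect q g :=
  expect_mono_support q fun a _ => h a

theorem expect_const (q : PMF α) (c : ℝ≥0∞) : expect q (fun _ => c) = c := by
  simp [expect, ENNReal.tsum_mul_right, q.tsum_coe]

theorem expect_le_const (q : PMF α) {f : α → ℝ≥0∞} {c : ℝ≥0∞} (h : ∀ a, f a ≤ c) :
    expect q f ≤ c :=
  (expect_mono q h).trans_eq (expect_const q c)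

theorem expect_mul_right (q : PMF α) (f : α → ℝ≥0∞) (c : ℝ≥0∞) :
    expect q (fun a => f a * c) = expect q f * c := by
  simp [expect, ← ENNReal.tsum_mul_right, mul_assoc]

theorem expect_add (q : PMF α) (f g : α → ℝ≥0∞) :
    expect q (fun a => f a + g a) = expect q f + expect q g := by
  simp [expect, mul_add, ENNReal.tsum_add]

theorem expect_sum {ι : Type*} (q : PMF α) (I : Finset ι) (f : ι → α → ℝ≥0∞) :
    expect q (fun a => ∑ i ∈ I, f i a) = ∑ i ∈ I, expect q (f i) := by
  classical
  induction I using Finset.induction_on with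
  | empty => simp [expect]
  | insert i I hi ih => simp only [Finset.sum_insert hi, expect_add, ih]

theorem toOuterMeasure_eq_expect (q : PMF α) (s : Set α) :
    q.toOuterMeasure s = expect q (s.indicator 1) := by
  rw [PMF.toOuterMeasure_apply, expect]
  refine tsum_congr fun a => ?_
  by_cases ha : a ∈ s <;> simp [ha]

/-- Markov's inequality, in the form used for exponential moments. Points of mass zero are exempt,
so that facts such as the length of a history are available. -/
theorem toOuterMeasure_le_expect (q : PMF α) {s : Set α} {f : α → ℝ≥0∞}
    (h : ∀ a ∈ s, q a ≠ 0 → 1 ≤ f a) : q.toOuterMeasure s ≤ expect q f := by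
  rw [toOuterMeasure_eq_expect]
  refine expect_mono_support q fun a ha => ?_
  by_cases has : a ∈ s
  · simpa [has] using h a has ha
  · simp [has]

/-- On the support the indicators of the good event `s` and the bad event `t` add up to at least
`1`. -/
theorem ofReal_one_sub_le_toOuterMeasure (q : PMF α) {s t : Set α} {p : ℝ} (hp : 0 ≤ p)
    (ht : q.toOuterMeasure t ≤ ENNReal.ofReal p) (h : ∀ a, q a ≠ 0 → a ∉ t → a ∈ s) :
    ENNReal.ofReal (1 - p) ≤ q.toOuterMeasure s := by
  have h1 : (1 : ℝ≥0∞) ≤ q.toOuterMeasure s + q.toOuterMeasure t := by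
    rw [toOuterMeasure_eq_expect, toOuterMeasure_eq_expect, ← expect_add,
      ← expect_const q 1]
    refine expect_mono_support q fun a ha => ?_
    by_cases hat : a ∈ t
    · simp [hat]
    · simp [h a ha hat]
  rw [ENNReal.ofReal_sub _ hp, ENNReal.ofReal_one]
  exact tsub_le_iff_right.2 (h1.trans (by gcongr))

theorem pmf_eq_of_subsingleton [Subsingleton α] (q q' : PMF α) : q = q' := by
  refine PMF.ext fun a => ?_
  have : ∀ q : PMF α, q a = 1 := fun q => by
    rw [← q.tsum_coe, tsum_eq_single a fun b hb => absurd (Subsingleton.elim b a) hb]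
  rw [this, this]

variable [Fintype α]

theorem sum_toReal_eq_one (q : PMF α) : ∑ a, (q a).toReal = 1 := by
  rw [← ENNReal.toReal_sum fun a _ => q.apply_ne_top a, ← tsum_fintype (L := .unconditional _),
    q.tsum_coe, ENNReal.toReal_one]

theorem expect_ofReal (q : PMF α) {f : α → ℝ} (hf : ∀ a, 0 ≤ f a) :
    expect q (fun a => ENNReal.ofReal (f a)) = ENNReal.ofReal (∑ a, (q a).toReal * f a) := by
  rw [expect, tsum_fintype, ENNReal.ofReal_sum_of_nonneg fun a _ =>
    mul_nonneg ENNReal.toReal_nonneg (hf a)]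
  refine Finset.sum_congr rfl fun a _ => ?_
  rw [ENNReal.ofReal_mul ENNReal.toReal_nonneg, ENNReal.ofReal_toReal (q.apply_ne_top a)]

theorem sum_toReal_mul_le (q : PMF α) {f g : α → ℝ} (h : ∀ a, f a ≤ g a) :
    ∑ a, (q a).toReal * f a ≤ ∑ a, (q a).toReal * g a :=
  Finset.sum_le_sum fun a _ => mul_le_mul_of_nonneg_left (h a) ENNReal.toReal_nonneg

theorem sum_toReal_mul_const (q : PMF α) (c : ℝ) : ∑ a, (q a).toReal * c = c := by
  rw [← Finset.sum_mul, sum_toReal_eq_one, one_mul]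

theorem sum_toReal_mul_mem_Icc (q : PMF α) {f : α → ℝ} {x y : ℝ} (h : ∀ a, f a ∈ Set.Icc x y) :
    ∑ a, (q a).toReal * f a ∈ Set.Icc x y :=
  ⟨(sum_toReal_mul_const q x).symm.trans_le (sum_toReal_mul_le q fun a => (h a).1),
    (sum_toReal_mul_le q fun a => (h a).2).trans_eq (sum_toReal_mul_const q y)⟩

theorem exp_le_one_add_add_sq {x : ℝ} (hx : |x| ≤ 1) : Real.exp x ≤ 1 + x + x ^ 2 := by
  have := (abs_le.1 (Real.abs_exp_sub_one_sub_id_le hx)).2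
  linarith

/-- A bounded centred random variable has a subgaussian moment generating function near `0`. -/
theorem expect_exp_le (q : PMF α) {g : α → ℝ} {r : ℝ} (hr : r ≤ 1) (hg : ∀ a, |g a| ≤ r)
    (h0 : ∑ a, (q a).toReal * g a = 0) :
    expect q (fun a => ENNReal.ofReal (Real.exp (g a))) ≤ ENNReal.ofReal (Real.exp (r ^ 2)) := by
  rw [expect_ofReal q fun a => (Real.exp_pos _).le]
  refine ENNReal.ofReal_le_ofReal ?_
  calc ∑ a, (q a).toReal * Real.exp (g a)
      ≤ ∑ a, (q a).toReal * (1 + r ^ 2 + g a) := by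
        refine sum_toReal_mul_le q fun a => ?_
        have h1 := exp_le_one_add_add_sq ((hg a).trans hr)
        have h2 : g a ^ 2 ≤ r ^ 2 := sq_le_sq' (abs_le.1 (hg a)).1 (abs_le.1 (hg a)).2
        linarith
    _ = 1 + r ^ 2 := by
        simp only [mul_add, Finset.sum_add_distrib, h0, sum_toReal_mul_const, mul_one,
          sum_toReal_eq_one, add_zero]
    _ ≤ Real.exp (r ^ 2) := by linarith [Real.add_one_le_exp (r ^ 2)]

end Expect

/-! ### Bilinear payoffs of matrix games -/

section Payoff

variable {X Y : Type*} [Fintype X] [Fintype Y]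

theorem payoff_eq (M : X → Y → ℝ) (φ : PMF X) (ψ : PMF Y) :
    payoff M φ ψ = ∑ a, (φ a).toReal * ∑ b, (ψ b).toReal * M a b := by
  simp only [payoff, Finset.mul_sum, mul_assoc]

theorem payoff_mono {M N : X → Y → ℝ} (h : ∀ a b, M a b ≤ N a b) (φ : PMF X) (ψ : PMF Y) :
    payoff M φ ψ ≤ payoff N φ ψ := by
  rw [payoff_eq, payoff_eq]
  exact sum_toReal_mul_le φ fun a => sum_toReal_mul_le ψ fun b => h a b

theorem payoff_mem_Icc {M : X → Y → ℝ} {x y : ℝ} (h : ∀ a b, M a b ∈ Set.Icc x y)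
    (φ : PMF X) (ψ : PMF Y) : payoff M φ ψ ∈ Set.Icc x y := by
  rw [payoff_eq]
  exact sum_toReal_mul_mem_Icc φ fun a => sum_toReal_mul_mem_Icc ψ fun b => h a b

theorem payoff_sub (M N : X → Y → ℝ) (φ : PMF X) (ψ : PMF Y) :
    payoff M φ ψ - payoff N φ ψ = payoff (fun a b => M a b - N a b) φ ψ := by
  simp only [payoff, mul_sub, Finset.sum_sub_distrib]

theorem payoff_const_mul (c : ℝ) (M : X → Y → ℝ) (φ : PMF X) (ψ : PMF Y) :
    payoff (fun a b => c * M a b) φ ψ = c * payoff M φ ψ := by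
  simp only [payoff, Finset.mul_sum]
  exact Finset.sum_congr rfl fun a _ => Finset.sum_congr rfl fun b _ => by ring

end Payoff

/-! ### Rollouts, Bellman equation, change of rewards -/

section Value

variable {S : ℕ → Type u} {A : ℕ → Type v} {B : ℕ → Type w}

theorem rollout_cons (G : MarkovGame S A B) (μ : Policy S A) (ν : Policy S B) (n h : ℕ) (s : S h)
    (a : A h) (b : B h) (s' : S (h + 1)) (τ : Traj S A B n (h + 1)) :
    rollout G μ ν (n + 1) h s (Traj.cons a b s' τ) =
      μ h s a * (ν h s b * (G.trans h s a b s' * rollout G μ ν n (h + 1) s' τ)) := by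
  rw [rollout, PMF.bind_apply, tsum_eq_single a]
  · congr 1
    rw [PMF.bind_apply, tsum_eq_single b]
    · congr 1
      rw [PMF.bind_apply, tsum_eq_single s']
      · congr 1
        rw [PMF.map_apply, tsum_eq_single τ]
        · simp
        · intro τ' h'
          simp [h'.symm]
      · intro x hx
        simp [PMF.map_apply, hx.symm]
    · intro x hx
      simp [PMF.map_apply, hx.symm]
  · intro x hx
    simp [PMF.map_apply, hx.symm]

theorem expect_rollout_succ (G : MarkovGame S A B) (μ : Policy S A) (ν : Policy S B) (n h : ℕ)
    (s : S h) (f : Traj S A B (n + 1) h → ℝ≥0∞) :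
    expect (rollout G μ ν (n + 1) h s) f =
      expect (μ h s) fun a => expect (ν h s) fun b => expect (G.trans h s a b) fun s' =>
        expect (rollout G μ ν n (h + 1) s') fun τ => f (Traj.cons a b s' τ) := by
  simp only [rollout, expect_bind, expect_map]

theorem cumReward_mem_Icc (G : MarkovGame S A B) : ∀ (n h : ℕ) (s : S h) (τ : Traj S A B n h),
    cumReward G n h s τ ∈ Set.Icc (0 : ℝ) n
  | 0, _, _, _ => by simp [cumReward]
  | n + 1, h, s, Traj.cons a b s' τ => by
    have h1 := cumReward_mem_Icc G n (h + 1) s' τ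
    have h2 := G.reward_mem h s a b
    rw [Set.mem_Icc] at h1 h2 ⊢
    rw [cumReward]
    push_cast
    constructor <;> linarith

/-- The game with the rewards replaced. -/
def MarkovGame.withReward (G : MarkovGame S A B) (r : ∀ h, S h → A h → B h → ℝ)
    (hr : ∀ h s a b, r h s a b ∈ Set.Icc (0 : ℝ) 1) : MarkovGame S A B where
  trans := G.trans
  reward := r
  reward_mem := hr

/-- Rewards do not influence the play, so values in the exploration game are expectations under the
law of the actual episodes. -/
theorem rollout_withReward (G : MarkovGame S A B) (r : ∀ h, S h → A h → B h → ℝ)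
    (hr : ∀ h s a b, r h s a b ∈ Set.Icc (0 : ℝ) 1) (μ : Policy S A) (ν : Policy S B) :
    ∀ (n h : ℕ) (s : S h), rollout (G.withReward r hr) μ ν n h s = rollout G μ ν n h s
  | 0, _, _ => rfl
  | n + 1, h, s => by
    simp only [rollout, rollout_withReward G r hr μ ν n]
    rfl

variable [∀ h, Fintype (S h)] [∀ h, Fintype (A h)] [∀ h, Fintype (B h)]

theorem sum_traj_succ {M : Type*} [AddCommMonoid M] (n h : ℕ) (f : Traj S A B (n + 1) h → M) :
    ∑ τ, f τ = ∑ a : A h, ∑ b : B h, ∑ s' : S (h + 1), ∑ τ : Traj S A B n (h + 1),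
      f (Traj.cons a b s' τ) := by
  rw [← (Traj.succEquiv S A B n h).sum_comp]
  simp only [Fintype.sum_prod_type]
  rfl

theorem value_zero (G : MarkovGame S A B) (μ : Policy S A) (ν : Policy S B) (h : ℕ) (s : S h) :
    value G μ ν 0 h s = 0 := by
  simp [value, cumReward]

/-- The Bellman equation. -/
theorem value_succ (G : MarkovGame S A B) (μ : Policy S A) (ν : Policy S B) (n h : ℕ) (s : S h) :
    value G μ ν (n + 1) h s = payoff (fun a b => G.reward h s a b +
      ∑ s', (G.trans h s a b s').toReal * value G μ ν n (h + 1) s') (μ h s) (ν h s) := by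
  rw [value, sum_traj_succ, payoff]
  refine Finset.sum_congr rfl fun a _ => Finset.sum_congr rfl fun b _ => ?_
  -- The reward is written as an average over the successors (and below over the remaining
  -- trajectories), so that the two sides can be compared term by term.
  rw [← sum_toReal_mul_const (G.trans h s a b) (G.reward h s a b), ← Finset.sum_add_distrib,
    Finset.mul_sum]
  refine Finset.sum_congr rfl fun s' _ => ?_
  rw [← mul_add, ← sum_toReal_mul_const (rollout G μ ν n (h + 1) s') (G.reward h s a b), value,
    ← Finset.sum_add_distrib, Finset.mul_sum, Finset.mul_sum]
  refine Finset.sum_congr rfl fun τ _ => ?_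
  rw [rollout_cons, cumReward]
  simp only [ENNReal.toReal_mul]
  ring

theorem value_mem_Icc (G : MarkovGame S A B) (μ : Policy S A) (ν : Policy S B) (n h : ℕ) (s : S h) :
    value G μ ν n h s ∈ Set.Icc (0 : ℝ) n :=
  sum_toReal_mul_mem_Icc _ fun τ => cumReward_mem_Icc G n h s τ

/-- Policies do not matter if every player has at most one action at each step. -/
theorem value_eq_of_card_le_one (G : MarkovGame S A B) {H : ℕ}
    (hA : ∀ h, h < H → Fintype.card (A h) ≤ 1) (hB : ∀ h, h < H → Fintype.card (B h) ≤ 1)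
    (μ μ' : Policy S A) (ν ν' : Policy S B) : ∀ (n h : ℕ) (s : S h), h + n ≤ H →
      value G μ ν n h s = value G μ' ν' n h s
  | 0, h, s, _ => by rw [value_zero, value_zero]
  | n + 1, h, s, hn => by
    have h1 : Subsingleton (A h) := Fintype.card_le_one_iff_subsingleton.1 (hA h (by omega))
    have h2 : Subsingleton (B h) := Fintype.card_le_one_iff_subsingleton.1 (hB h (by omega))
    rw [value_succ, value_succ, pmf_eq_of_subsingleton (μ h s) (μ' h s),
      pmf_eq_of_subsingleton (ν h s) (ν' h s)]
    simp only [value_eq_of_card_le_one G hA hB μ μ' ν ν' n (h + 1) _ (by omega)]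

end Value

/-! ### Evolution of the tables and the law of histories -/

section Histories

variable {S : ℕ → Type u} {A : ℕ → Type v} {B : ℕ → Type w}

theorem record_visits_of_ne (D : Tables S A B) {h i : ℕ} (hi : i ≠ h) (s : S h) (a : A h) (b : B h)
    (r : ℝ) (s' : S (h + 1)) : (D.record h s a b r s').visits i = D.visits i := by
  funext x y z
  simp [Tables.record, hi]

theorem record_visits_self (D : Tables S A B) (h : ℕ) (s : S h) (a : A h) (b : B h)
    (r : ℝ) (s' : S (h + 1)) : (D.record h s a b r s').visits h s a b = D.visits h s a b + 1 := by
  simp [Tables.record]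

theorem record_of_ne (D : Tables S A B) {h i : ℕ} {s : S h} {a : A h} {b : B h}
    {x : S i} {y : A i} {z : B i}
    (hne : (⟨i, x, y, z⟩ : Σ i, S i × A i × B i) ≠ ⟨h, s, a, b⟩) (r : ℝ) (s' : S (h + 1)) :
    (D.record h s a b r s').visits i x y z = D.visits i x y z ∧
      (D.record h s a b r s').moves i x y z = D.moves i x y z ∧
      (D.record h s a b r s').rhat i x y z = D.rhat i x y z := by
  refine ⟨if_neg hne, funext fun x' => if_neg ?_, if_neg hne⟩
  intro he
  apply hne
  cases he
  rfl

/-- The tables agree with the game where something was observed, and transition counts add up to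
visit counts. -/
structure Tables.Valid [∀ h, Fintype (S h)] (G : MarkovGame S A B) (D : Tables S A B) : Prop where
  sum_moves : ∀ h s a b, ∑ s', D.moves h s a b s' = D.visits h s a b
  rhat_eq : ∀ h s a b, D.visits h s a b ≠ 0 → D.rhat h s a b = G.reward h s a b

/-- The deviation of the observed sum of `g` over the successors of `(s, a, b)` from its
conditional mean. -/
noncomputable def Tables.deviation [∀ h, Fintype (S h)] (G : MarkovGame S A B) (D : Tables S A B)
    (h : ℕ) (s : S h) (a : A h) (b : B h) (g : S (h + 1) → ℝ) : ℝ :=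
  ∑ x, (D.moves h s a b x : ℝ) * g x -
    D.visits h s a b * ∑ x, (G.trans h s a b x).toReal * g x

/-! ### Recording one transition: the exponential supermartingale -/

section Record

variable [∀ h, Fintype (S h)]

theorem deviation_record_self (G : MarkovGame S A B) (D : Tables S A B) (h : ℕ) (s : S h)
    (a : A h) (b : B h) (r : ℝ) (s' : S (h + 1)) (g : S (h + 1) → ℝ) :
    (D.record h s a b r s').deviation G h s a b g =
      D.deviation G h s a b g + (g s' - ∑ x, (G.trans h s a b x).toReal * g x) := by
  classical
  have h1 : ∀ x, ((D.record h s a b r s').moves h s a b x : ℝ) =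
      D.moves h s a b x + if x = s' then 1 else 0 := by
    intro x
    by_cases hx : x = s' <;> simp [Tables.record, hx]
  rw [Tables.deviation, Tables.deviation, record_visits_self]
  simp only [h1, add_mul, Finset.sum_add_distrib, ite_mul, one_mul, zero_mul, Finset.sum_ite_eq',
    Finset.mem_univ, if_true, Nat.cast_add, Nat.cast_one]
  ring

theorem Tables.Valid.record {G : MarkovGame S A B} {D : Tables S A B} (hD : D.Valid G) (h : ℕ)
    (s : S h) (a : A h) (b : B h) (s' : S (h + 1)) :
    (D.record h s a b (G.reward h s a b) s').Valid G := by
  classical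
  constructor
  · intro i x y z
    by_cases he : (⟨i, x, y, z⟩ : Σ i, S i × A i × B i) = ⟨h, s, a, b⟩
    · cases he
      have h1 : ∀ x, (D.record h s a b (G.reward h s a b) s').moves h s a b x =
          D.moves h s a b x + if x = s' then 1 else 0 := by
        intro x
        by_cases hx : x = s' <;> simp [Tables.record, hx]
      rw [record_visits_self]
      simp [h1, Finset.sum_add_distrib, hD.sum_moves]
    · obtain ⟨e1, e2, -⟩ := record_of_ne D he (G.reward h s a b) s'
      rw [e1, e2, hD.sum_moves]
  · intro i x y z hv
    by_cases he : (⟨i, x, y, z⟩ : Σ i, S i × A i × B i) = ⟨h, s, a, b⟩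
    · cases he
      simp [Tables.record]
    · obtain ⟨e1, -, e3⟩ := record_of_ne D he (G.reward h s a b) s'
      rw [e1] at hv
      rw [e3, hD.rhat_eq i x y z hv]

theorem Tables.Valid.recordTraj {G : MarkovGame S A B} : ∀ (n h : ℕ) (s : S h)
    (τ : Traj S A B n h) {D : Tables S A B}, D.Valid G → (Tables.recordTraj G n h s τ D).Valid G
  | 0, _, _, _, _, hD => by simpa only [Tables.recordTraj] using hD
  | n + 1, h, s, Traj.cons a b s' τ, _, hD =>
    Tables.Valid.recordTraj n (h + 1) s' τ (hD.record h s a b s')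

theorem tables_valid (G : MarkovGame S A B) {H : ℕ} : ∀ hist : History S A B H,
    (tables G hist).Valid G
  | [] => ⟨by simp [tables, Tables.init], by simp [tables, Tables.init]⟩
  | e :: hist => (tables_valid G hist).recordTraj H 0 e.1 e.2

/-- The exponential weight of a deviation. -/
noncomputable def Tables.weight (G : MarkovGame S A B) (D : Tables S A B)
    (h : ℕ) (s : S h) (a : A h) (b : B h) (g : S (h + 1) → ℝ) (l : ℝ) : ℝ≥0∞ :=
  ENNReal.ofReal (Real.exp (l * D.deviation G h s a b g - l ^ 2 * D.visits h s a b))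

/-- A visit to `(x, y, z)` adds a centred increment of size at most `1` to the deviation, which
costs a factor of at most `exp (l²)` in expectation; the count grows by one and pays it back. Any
other visit leaves the weight unchanged. -/
theorem expect_weight_record_le (G : MarkovGame S A B) (D : Tables S A B)
    {i : ℕ} (x : S i) (y : A i) (z : B i) {g : S (i + 1) → ℝ} (hg : ∀ x, g x ∈ Set.Icc (0 : ℝ) 1)
    {l : ℝ} (hl0 : 0 ≤ l) (hl1 : l ≤ 1) (h : ℕ) (s : S h) (a : A h) (b : B h) (r : ℝ) :
    expect (G.trans h s a b) (fun s' => (D.record h s a b r s').weight G i x y z g l) ≤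
      D.weight G i x y z g l := by
  by_cases he : (⟨i, x, y, z⟩ : Σ i, S i × A i × B i) = ⟨h, s, a, b⟩
  · cases he
    set m := ∑ t, (G.trans i x y z t).toReal * g t with hm
    have hmem : m ∈ Set.Icc (0 : ℝ) 1 := sum_toReal_mul_mem_Icc _ hg
    have h1 : ∀ s', (D.record i x y z r s').weight G i x y z g l =
        ENNReal.ofReal (Real.exp (l * (g s' - m))) *
          (ENNReal.ofReal (Real.exp (-l ^ 2)) * D.weight G i x y z g l) := by
      intro s'
      rw [Tables.weight, Tables.weight, deviation_record_self, record_visits_self, ← hm,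
        ← ENNReal.ofReal_mul (Real.exp_pos _).le, ← Real.exp_add,
        ← ENNReal.ofReal_mul (Real.exp_pos _).le, ← Real.exp_add]
      congr 2
      push_cast
      ring
    simp only [h1, expect_mul_right]
    have h2 : expect (G.trans i x y z) (fun s' => ENNReal.ofReal (Real.exp (l * (g s' - m)))) ≤
        ENNReal.ofReal (Real.exp (l ^ 2)) := by
      refine expect_exp_le _ hl1 (fun s' => ?_) ?_
      · rw [abs_mul, abs_of_nonneg hl0]
        have : |g s' - m| ≤ 1 := abs_le.2 ⟨by linarith [(hg s').1, hmem.2],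
          by linarith [(hg s').2, hmem.1]⟩
        exact mul_le_of_le_one_right hl0 this
      · calc ∑ t, (G.trans i x y z t).toReal * (l * (g t - m))
            = l * (∑ t, (G.trans i x y z t).toReal * g t -
                ∑ t, (G.trans i x y z t).toReal * m) := by
              rw [← Finset.sum_sub_distrib, Finset.mul_sum]
              exact Finset.sum_congr rfl fun t _ => by ring
          _ = 0 := by rw [sum_toReal_mul_const, ← hm, sub_self, mul_zero]
    refine (mul_le_mul_left h2 _).trans_eq ?_
    rw [← mul_assoc, ← ENNReal.ofReal_mul (Real.exp_pos _).le, ← Real.exp_add]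
    simp
  · refine expect_le_const _ fun s' => ?_
    obtain ⟨e1, e2, -⟩ := record_of_ne D he r s'
    rw [Tables.weight, Tables.weight, Tables.deviation, Tables.deviation, e1, e2]

end Record

/-- The one-step inequality holds for every fixed pair of actions, so the policies, which depend on
the past, play no role. -/
theorem expect_recordTraj_le (G : MarkovGame S A B) (μ : Policy S A) (ν : Policy S B)
    (W : Tables S A B → ℝ≥0∞) (hW : ∀ D h s a b, expect (G.trans h s a b)
      (fun s' => W (D.record h s a b (G.reward h s a b) s')) ≤ W D) :
    ∀ (n h : ℕ) (s : S h) (D : Tables S A B),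
      expect (rollout G μ ν n h s) (fun τ => W (Tables.recordTraj G n h s τ D)) ≤ W D
  | 0, h, s, D => by simp [rollout, expect_pure, Tables.recordTraj]
  | n + 1, h, s, D => by
    rw [expect_rollout_succ]
    refine expect_le_const _ fun a => expect_le_const _ fun b => le_trans ?_ (hW D h s a b)
    refine expect_mono _ fun s' => ?_
    simp only [Tables.recordTraj]
    exact expect_recordTraj_le G μ ν W hW n (h + 1) s' _

/-! ### Supermartingales and union bounds over episodes -/

section Law

variable [∀ h, Fintype (S h)] [∀ h, Fintype (A h)] [∀ h, Fintype (B h)]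
  (G : MarkovGame S A B) {H : ℕ} (β : ℕ → ℝ) (nash : History S A B H → Solver S A B)
  (adv : History S A B H → PMF (S 0))

/-- Each episode multiplies the expectation by at most `c`, whatever initial state the adversary
picks. It serves with `c = 1` for the weights and with `c > 1` for the moment generating function of
the noise. -/
theorem expect_historyLaw_le (f : History S A B H → ℝ≥0∞) (c : ℝ≥0∞)
    (hf : ∀ hist s, expect (rollout G (maxPolicy G β nash hist) (minPolicy G β nash hist) H 0 s)
      (fun τ => f ((s, τ) :: hist)) ≤ f hist * c) :
    ∀ k, expect (historyLaw G β nash adv k) f ≤ f [] * c ^ k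
  | 0 => by simp [historyLaw, expect_pure]
  | k + 1 => by
    rw [historyLaw]
    simp only [expect_bind, expect_map]
    calc _ ≤ expect (historyLaw G β nash adv k) fun hist => f hist * c :=
          expect_mono _ fun hist => expect_le_const _ fun s => hf hist s
      _ ≤ _ := by
        rw [expect_mul_right, pow_succ, ← mul_assoc]
        exact mul_le_mul_left (expect_historyLaw_le f c hf k) _

theorem length_of_historyLaw_ne_zero : ∀ (k : ℕ) (hist : History S A B H),
    historyLaw G β nash adv k hist ≠ 0 → hist.length = k
  | 0, hist, h => by
    rw [← PMF.mem_support_iff, historyLaw, PMF.mem_support_pure_iff] at h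
    simp [h]
  | k + 1, hist, h => by
    simp only [← PMF.mem_support_iff, historyLaw, PMF.mem_support_bind_iff,
      PMF.mem_support_map_iff] at h
    obtain ⟨hist', h1, s, -, τ, -, rfl⟩ := h
    simp [length_of_historyLaw_ne_zero k hist' h1]

/-- Every history that precedes one of the episodes in a given history satisfies `P`. -/
def AllPrefixes (P : History S A B H → Prop) : History S A B H → Prop
  | [] => True
  | _ :: hist => AllPrefixes P hist ∧ P hist

theorem toOuterMeasure_not_allPrefixes_le (P : History S A B H → Prop) (ε : ℝ≥0∞) :
    ∀ k, (∀ j < k, (historyLaw G β nash adv j).toOuterMeasure {hist | ¬ P hist} ≤ ε) →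
      (historyLaw G β nash adv k).toOuterMeasure {hist | ¬ AllPrefixes P hist} ≤ k * ε
  | 0, _ => by
    rw [toOuterMeasure_eq_expect, historyLaw, expect_pure]
    simp [AllPrefixes]
  | k + 1, h => by
    have h1 := toOuterMeasure_not_allPrefixes_le P ε k fun j hj => h j (by omega)
    have h2 := h k (by omega)
    rw [toOuterMeasure_eq_expect] at h1 h2 ⊢
    rw [historyLaw]
    simp only [expect_bind, expect_map]
    push_cast
    rw [add_mul, one_mul]
    refine le_trans ?_ (add_le_add h1 h2)
    rw [← expect_add]
    refine expect_mono _ fun hist => expect_le_const _ fun s => expect_le_const _ fun τ => ?_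
    by_cases p1 : AllPrefixes P hist <;> by_cases p2 : P hist <;> simp [AllPrefixes, p1, p2]

theorem expect_weight_tables_le {i : ℕ} (x : S i) (y : A i) (z : B i) {g : S (i + 1) → ℝ}
    (hg : ∀ x, g x ∈ Set.Icc (0 : ℝ) 1) {l : ℝ} (hl0 : 0 ≤ l) (hl1 : l ≤ 1) (k : ℕ) :
    expect (historyLaw G β nash adv k) (fun hist => (tables G hist).weight G i x y z g l) ≤ 1 := by
  refine (expect_historyLaw_le G β nash adv _ 1 (fun hist s => ?_) k).trans ?_
  · rw [mul_one]
    exact expect_recordTraj_le G _ _ (fun D => D.weight G i x y z g l)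
      (fun D h s a b => expect_weight_record_le G D x y z hg hl0 hl1 h s a b _) H 0 s _
  · simp [Tables.weight, Tables.deviation, tables, Tables.init]

end Law

/-! ### Visit counts -/

section Visits

theorem visits_recordTraj_of_lt (G : MarkovGame S A B) : ∀ (n h : ℕ) (s : S h)
    (τ : Traj S A B n h) (D : Tables S A B) {i : ℕ}, i < h →
      (Tables.recordTraj G n h s τ D).visits i = D.visits i
  | 0, _, _, _, _, _, _ => by simp only [Tables.recordTraj]
  | n + 1, h, s, Traj.cons a b s' τ, D, i, hi => by
    rw [Tables.recordTraj, visits_recordTraj_of_lt G n (h + 1) s' τ _ (by omega),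
      record_visits_of_ne D (by omega)]

/-- After multiplication by `√(t + 1)` this is `(√(t + 1) - √t)² ≥ 0`. -/
theorem inv_sqrt_succ_le (t : ℕ) : 1 / √((t : ℝ) + 1) ≤ 2 * √((t + 1 : ℕ) : ℝ) - 2 * √(t : ℝ) := by
  push_cast
  have h1 : 0 < √((t : ℝ) + 1) := Real.sqrt_pos.2 (by positivity)
  have h2 := Real.sq_sqrt (show (0 : ℝ) ≤ (t : ℝ) + 1 by positivity)
  have h3 := Real.sq_sqrt (show (0 : ℝ) ≤ (t : ℝ) by positivity)
  rw [div_le_iff₀ h1]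
  nlinarith [sq_nonneg (√((t : ℝ) + 1) - √(t : ℝ))]

/-- The reward `min 1 (l / √(N + 1))` of exploring. -/
noncomputable def exploreReward (l : ℝ) (D : Tables S A B) (h : ℕ) (s : S h) (a : A h) (b : B h) :
    ℝ :=
  min 1 (l / √((D.visits h s a b : ℝ) + 1))

theorem exploreReward_mem_Icc {l : ℝ} (hl : 0 ≤ l) (D : Tables S A B) (h : ℕ) (s : S h) (a : A h)
    (b : B h) : exploreReward l D h s a b ∈ Set.Icc (0 : ℝ) 1 :=
  ⟨le_min zero_le_one (by positivity), min_le_left _ _⟩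

/-- The game in which exploring is rewarded. -/
noncomputable def exploreGame (G : MarkovGame S A B) (l : ℝ) (hl : 0 ≤ l) (D : Tables S A B) :
    MarkovGame S A B :=
  G.withReward (exploreReward l D) (exploreReward_mem_Icc hl D)

variable [∀ h, Fintype (S h)] [∀ h, Fintype (A h)] [∀ h, Fintype (B h)]

/-- The sum of `f (N_h(s, a, b))` over all `(s, a, b)`. -/
def Tables.sumVisits (f : ℕ → ℝ) (D : Tables S A B) (h : ℕ) : ℝ :=
  ∑ x : S h × A h × B h, f (D.visits h x.1 x.2.1 x.2.2)

theorem sumVisits_record_self (f : ℕ → ℝ) (D : Tables S A B) (h : ℕ) (s : S h) (a : A h) (b : B h)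
    (r : ℝ) (s' : S (h + 1)) :
    (D.record h s a b r s').sumVisits f h =
      D.sumVisits f h + (f (D.visits h s a b + 1) - f (D.visits h s a b)) := by
  classical
  have h1 : ∀ x : S h × A h × B h, f ((D.record h s a b r s').visits h x.1 x.2.1 x.2.2) =
      f (D.visits h x.1 x.2.1 x.2.2) +
        if x = (s, a, b) then f (D.visits h s a b + 1) - f (D.visits h s a b) else 0 := by
    rintro ⟨x, y, z⟩
    by_cases hx : (x, y, z) = (s, a, b)
    · rw [if_pos hx]
      cases hx
      simp [record_visits_self]
    · rw [if_neg hx]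
      simp only [Tables.record]
      rw [if_neg (fun he => hx (by simpa using he)), add_zero]
  simp only [Tables.sumVisits, h1, Finset.sum_add_distrib, Finset.sum_ite_eq', Finset.mem_univ,
    if_true]

theorem sumVisits_record_of_ne (f : ℕ → ℝ) (D : Tables S A B) {h i : ℕ} (hi : i ≠ h) (s : S h)
    (a : A h) (b : B h) (r : ℝ) (s' : S (h + 1)) :
    (D.record h s a b r s').sumVisits f i = D.sumVisits f i := by
  simp only [Tables.sumVisits, record_visits_of_ne D hi]

theorem sumVisits_cast_recordTraj_le (G : MarkovGame S A B) (i : ℕ) : ∀ (n h : ℕ) (s : S h)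
    (τ : Traj S A B n h) (D : Tables S A B),
      (Tables.recordTraj G n h s τ D).sumVisits (fun t => (t : ℝ)) i ≤
        D.sumVisits (fun t => (t : ℝ)) i + 1
  | 0, _, _, _, _ => by simp [Tables.recordTraj]
  | n + 1, h, s, Traj.cons a b s' τ, D => by
    rw [Tables.recordTraj]
    by_cases hi : i = h
    · subst hi
      rw [Tables.sumVisits, visits_recordTraj_of_lt G n (i + 1) s' τ _ (by omega),
        ← Tables.sumVisits, sumVisits_record_self]
      push_cast
      linarith
    · refine (sumVisits_cast_recordTraj_le G i n (h + 1) s' τ _).trans_eq ?_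
      rw [sumVisits_record_of_ne _ D hi]

theorem sumVisits_cast_tables_le (G : MarkovGame S A B) {H : ℕ} (i : ℕ) :
    ∀ hist : History S A B H, (tables G hist).sumVisits (fun t => (t : ℝ)) i ≤ hist.length
  | [] => by simp [tables, Tables.init, Tables.sumVisits]
  | e :: hist => by
    have h1 := sumVisits_cast_tables_le G i hist
    have h2 := sumVisits_cast_recordTraj_le G i H 0 e.1 e.2 (tables G hist)
    rw [tables, List.length_cons]
    push_cast
    linarith

theorem visits_tables_le (G : MarkovGame S A B) {H : ℕ} (hist : History S A B H) (h : ℕ) (s : S h)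
    (a : A h) (b : B h) : (tables G hist).visits h s a b ≤ hist.length := by
  have h1 := sumVisits_cast_tables_le G h hist
  have h2 : ((tables G hist).visits h s a b : ℝ) ≤
      (tables G hist).sumVisits (fun t => (t : ℝ)) h :=
    Finset.single_le_sum (f := fun x : S h × A h × B h =>
      ((tables G hist).visits h x.1 x.2.1 x.2.2 : ℝ)) (fun x _ => Nat.cast_nonneg _)
      (Finset.mem_univ (s, a, b))
  exact_mod_cast h2.trans h1

/-- A potential that grows by at least `1 / √(N + 1)` with each visit. -/
noncomputable def Tables.potential (D : Tables S A B) (H : ℕ) : ℝ :=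
  ∑ h ∈ Finset.range H, D.sumVisits (fun t => 2 * √(t : ℝ)) h

theorem potential_record (D : Tables S A B) {H h : ℕ} (hh : h < H) (s : S h) (a : A h) (b : B h)
    (r : ℝ) (s' : S (h + 1)) :
    D.potential H + 1 / √((D.visits h s a b : ℝ) + 1) ≤
      (D.record h s a b r s').potential H := by
  rw [Tables.potential, Tables.potential, ← Finset.add_sum_erase _ _ (Finset.mem_range.2 hh),
    ← Finset.add_sum_erase _ _ (Finset.mem_range.2 hh), sumVisits_record_self,
    Finset.sum_congr rfl fun i hi => sumVisits_record_of_ne _ D (Finset.ne_of_mem_erase hi) ..]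
  linarith [inv_sqrt_succ_le (D.visits h s a b)]

/-- The rewards are computed from the tables `D` before the episode, whereas the potential follows
the running tables `D'`. An episode acts only once at each step, so both agree on the counts from
the current step on. -/
theorem cumReward_exploreGame_le (G : MarkovGame S A B) {l : ℝ} (hl : 0 ≤ l) (D : Tables S A B)
    {H : ℕ} : ∀ (n h : ℕ) (s : S h) (τ : Traj S A B n h) (D' : Tables S A B), h + n ≤ H →
      (∀ i, h ≤ i → D'.visits i = D.visits i) →
        cumReward (exploreGame G l hl D) n h s τ ≤
          l * ((Tables.recordTraj G n h s τ D').potential H - D'.potential H)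
  | 0, _, _, _, _, _, _ => by simp [Tables.recordTraj, cumReward]
  | n + 1, h, s, Traj.cons a b s' τ, D', hn, hD => by
    rw [Tables.recordTraj, cumReward]
    have h1 := cumReward_exploreGame_le G hl D (H := H) n (h + 1) s' τ
      (D'.record h s a b (G.reward h s a b) s') (by omega) fun i hi => by
        rw [record_visits_of_ne D' (by omega), hD i (by omega)]
    have h2 := potential_record D' (show h < H by omega) s a b (G.reward h s a b) s'
    have h3 : (exploreGame G l hl D).reward h s a b ≤
        l * (1 / √((D'.visits h s a b : ℝ) + 1)) := by
      rw [hD h le_rfl, mul_one_div]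
      exact min_le_right _ _
    have h4 := mul_le_mul_of_nonneg_left h2 hl
    rw [mul_add] at h4
    rw [mul_sub] at h1 ⊢
    linarith

theorem potential_tables_le (G : MarkovGame S A B) {H nS : ℕ}
    (hS : ∀ h, h ≤ H → Fintype.card (S h) ≤ nS) (hist : History S A B H) :
    (tables G hist).potential H ≤ H * (2 * √((nS : ℝ) * maxActionPairs A B H * hist.length)) := by
  have key : ∀ h ∈ Finset.range H, (tables G hist).sumVisits (fun t => 2 * √(t : ℝ)) h ≤
      2 * √((nS : ℝ) * maxActionPairs A B H * hist.length) := by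
    intro h hh
    have hM : Fintype.card (A h) * Fintype.card (B h) ≤ maxActionPairs A B H :=
      Finset.le_sup (f := fun h => Fintype.card (A h) * Fintype.card (B h)) hh
    have hc : Fintype.card (S h × A h × B h) ≤ nS * maxActionPairs A B H := by
      rw [Fintype.card_prod, Fintype.card_prod]
      exact Nat.mul_le_mul (hS h (Finset.mem_range.1 hh).le) hM
    have hc' : (Fintype.card (S h × A h × B h) : ℝ) ≤ (nS : ℝ) * maxActionPairs A B H := by
      exact_mod_cast hc
    rw [Tables.sumVisits, ← Finset.mul_sum]
    refine mul_le_mul_of_nonneg_left (Real.le_sqrt_of_sq_le ?_) zero_le_two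
    -- Cauchy-Schwarz; the counts of one step sum to at most the number of episodes.
    refine sq_sum_le_card_mul_sum_sq.trans ?_
    simp only [Real.sq_sqrt (Nat.cast_nonneg _), Finset.card_univ]
    exact mul_le_mul hc' (sumVisits_cast_tables_le G h hist)
      (Finset.sum_nonneg fun _ _ => Nat.cast_nonneg _) (by positivity)
  refine (Finset.sum_le_card_nsmul _ _ _ key).trans_eq ?_
  rw [Finset.card_range, nsmul_eq_mul]

end Visits

end Histories

/-! ### Upper and lower confidence bounds -/

section Confidence

variable {S : ℕ → Type u} {A : ℕ → Type v} {B : ℕ → Type w}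

/-- The empirical transition probabilities of all events are close to the true ones. -/
def Tables.Accurate (G : MarkovGame S A B) (D : Tables S A B) (H : ℕ) (δ : ℝ) : Prop :=
  ∀ h < H, ∀ s a b, D.visits h s a b ≠ 0 → ∀ U : Finset (S (h + 1)),
    ∑ x ∈ U, (D.phat h s a b x - (G.trans h s a b x).toReal) ≤ δ / √(D.visits h s a b : ℝ)

/-- A signed measure of total mass zero integrates functions with values in `[0, m]` to at most
`m` times its largest value on a set. -/
theorem abs_sum_mul_le {X : Type*} [Fintype X] {d f : X → ℝ} {m e : ℝ} (hm : 0 ≤ m)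
    (h0 : ∑ x, d x = 0) (hd : ∀ U : Finset X, ∑ x ∈ U, d x ≤ e)
    (hf : ∀ x, f x ∈ Set.Icc 0 m) : |∑ x, d x * f x| ≤ m * e := by
  classical
  have up : ∀ g : X → ℝ, (∀ x, g x ∈ Set.Icc 0 m) → ∑ x, d x * g x ≤ m * e := by
    intro g hg
    calc ∑ x, d x * g x ≤ ∑ x, if 0 < d x then m * d x else 0 := by
          refine Finset.sum_le_sum fun x _ => ?_
          split_ifs with hx
          · rw [mul_comm]
            exact mul_le_mul_of_nonneg_right (hg x).2 hx.le
          · exact mul_nonpos_of_nonpos_of_nonneg (not_lt.1 hx) (hg x).1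
      _ = m * ∑ x ∈ Finset.univ.filter fun x => 0 < d x, d x := by
          rw [← Finset.sum_filter, Finset.mul_sum]
      _ ≤ m * e := mul_le_mul_of_nonneg_left (hd _) hm
  refine abs_le.2 ⟨?_, up f hf⟩
  -- As the total mass is zero, replacing `f` by `m - f` flips the sign of the integral.
  have h1 := up (fun x => m - f x) fun x => ⟨by linarith [(hf x).2], by linarith [(hf x).1]⟩
  have h2 : ∑ x, d x * (m - f x) = -∑ x, d x * f x := by
    simp only [mul_sub, Finset.sum_sub_distrib, ← Finset.sum_mul, h0, zero_mul, zero_sub]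
  linarith

theorem Tables.phat_nonneg (D : Tables S A B) (h : ℕ) (s : S h) (a : A h) (b : B h)
    (x : S (h + 1)) : 0 ≤ D.phat h s a b x := by
  unfold Tables.phat
  positivity

variable [∀ h, Fintype (S h)]

theorem Tables.Valid.sum_phat {G : MarkovGame S A B} {D : Tables S A B} (hD : D.Valid G) {h : ℕ}
    {s : S h} {a : A h} {b : B h} (hv : D.visits h s a b ≠ 0) : ∑ x, D.phat h s a b x = 1 := by
  simp only [Tables.phat, ← Finset.sum_div, ← Nat.cast_sum, hD.sum_moves]
  exact div_self (Nat.cast_ne_zero.2 hv)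

theorem Tables.Valid.abs_sum_phat_sub_le {G : MarkovGame S A B} {D : Tables S A B}
    (hD : D.Valid G) {H : ℕ} {δ : ℝ} (hacc : D.Accurate G H δ) {h : ℕ} (hh : h < H)
    {s : S h} {a : A h} {b : B h} (hv : D.visits h s a b ≠ 0) {f : S (h + 1) → ℝ}
    (hf : ∀ x, f x ∈ Set.Icc (0 : ℝ) H) :
    |∑ x, D.phat h s a b x * f x - ∑ x, (G.trans h s a b x).toReal * f x| ≤
      H * (δ / √(D.visits h s a b : ℝ)) := by
  rw [← Finset.sum_sub_distrib]
  simp only [← sub_mul]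
  refine abs_sum_mul_le (Nat.cast_nonneg H) ?_ (hacc h hh s a b hv) hf
  rw [Finset.sum_sub_distrib, hD.sum_phat hv, sum_toReal_eq_one, sub_self]

theorem Tables.Valid.sum_phat_mul_mem_Icc {G : MarkovGame S A B} {D : Tables S A B}
    (hD : D.Valid G) {h : ℕ} {s : S h} {a : A h} {b : B h} (hv : D.visits h s a b ≠ 0)
    {f : S (h + 1) → ℝ} {x y : ℝ} (hf : ∀ s', f s' ∈ Set.Icc x y) :
    ∑ s', D.phat h s a b s' * f s' ∈ Set.Icc x y := by
  have h1 : ∀ z : ℝ, ∑ s', D.phat h s a b s' * z = z := fun z => by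
    rw [← Finset.sum_mul, hD.sum_phat hv, one_mul]
  constructor
  · rw [← h1 x]
    exact Finset.sum_le_sum fun s' _ =>
      mul_le_mul_of_nonneg_left (hf s').1 (D.phat_nonneg h s a b s')
  · rw [← h1 y]
    exact Finset.sum_le_sum fun s' _ =>
      mul_le_mul_of_nonneg_left (hf s').2 (D.phat_nonneg h s a b s')

theorem sum_phat_mul_mono (D : Tables S A B) {h : ℕ} (s : S h) (a : A h) (b : B h)
    {f g : S (h + 1) → ℝ} (hfg : ∀ x, f x ≤ g x) :
    ∑ x, D.phat h s a b x * f x ≤ ∑ x, D.phat h s a b x * g x :=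
  Finset.sum_le_sum fun x _ => mul_le_mul_of_nonneg_left (hfg x) (D.phat_nonneg h s a b x)

theorem qUp_mem_Icc {G : MarkovGame S A B} {H : ℕ} {β : ℕ → ℝ}
    {D : Tables S A B} (hD : D.Valid G) (hβ : ∀ t, 0 ≤ β t) {h : ℕ} {V : S (h + 1) → ℝ}
    (hV : ∀ x, V x ∈ Set.Icc (0 : ℝ) H) (s : S h) (a : A h) (b : B h) :
    qUp H β D h V s a b ∈ Set.Icc (0 : ℝ) H := by
  rw [qUp]
  split_ifs with hv
  · exact ⟨Nat.cast_nonneg _, le_rfl⟩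
  · refine ⟨le_min ?_ (Nat.cast_nonneg _), min_le_right _ _⟩
    rw [hD.rhat_eq h s a b hv]
    linarith [(G.reward_mem h s a b).1, hβ (D.visits h s a b), (hD.sum_phat_mul_mem_Icc hv hV).1]

/-- The lower estimate is not truncated from above, so its upper bound has to come from the number
of remaining steps. -/
theorem qLow_mem_Icc {G : MarkovGame S A B} {β : ℕ → ℝ} {D : Tables S A B}
    (hD : D.Valid G) (hβ : ∀ t, 0 ≤ β t) {n h : ℕ} {V : S (h + 1) → ℝ}
    (hV : ∀ x, V x ∈ Set.Icc (0 : ℝ) n) (s : S h) (a : A h) (b : B h) :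
    qLow β D h V s a b ∈ Set.Icc (0 : ℝ) (n + 1 : ℕ) := by
  rw [qLow]
  split_ifs with hv
  · exact ⟨le_rfl, Nat.cast_nonneg _⟩
  · refine ⟨le_max_right _ _, max_le ?_ (Nat.cast_nonneg _)⟩
    rw [hD.rhat_eq h s a b hv]
    push_cast
    linarith [(G.reward_mem h s a b).2, hβ (D.visits h s a b), (hD.sum_phat_mul_mem_Icc hv hV).2]

variable [∀ h, Fintype (A h)] [∀ h, Fintype (B h)]
  {G : MarkovGame S A B} {H : ℕ} {β : ℕ → ℝ} {nash : Solver S A B} {D : Tables S A B} {δ l : ℝ}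

theorem vEst_succ_fst {n h : ℕ} (hn : h + (n + 1) = H) (s : S h) :
    (vEst H β nash D (n + 1) h).1 s = payoff (qUp H β D h (vEst H β nash D n (h + 1)).1 s)
      (plan H β nash D h s).1 (plan H β nash D h s).2 := by
  have h1 : H - (h + 1) = n := by omega
  rw [vEst, plan, h1]

theorem vEst_succ_snd {n h : ℕ} (hn : h + (n + 1) = H) (s : S h) :
    (vEst H β nash D (n + 1) h).2 s = payoff (qLow β D h (vEst H β nash D n (h + 1)).2 s)
      (plan H β nash D h s).1 (plan H β nash D h s).2 := by
  have h1 : H - (h + 1) = n := by omega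
  rw [vEst, plan, h1]

theorem plan_isNash (hnash : nash.IsCorrect) {n h : ℕ} (hn : h + (n + 1) = H) (s : S h) :
    IsNash (qUp H β D h (vEst H β nash D n (h + 1)).1 s)
      (qLow β D h (vEst H β nash D n (h + 1)).2 s)
      (plan H β nash D h s).1 (plan H β nash D h s).2 := by
  have h1 : H - (h + 1) = n := by omega
  rw [plan, h1]
  exact hnash _ _ _ _

theorem vEst_fst_mem_Icc (hD : D.Valid G) (hβ : ∀ t, 0 ≤ β t) : ∀ {n h : ℕ}, h + n = H →
    ∀ s, (vEst H β nash D n h).1 s ∈ Set.Icc (0 : ℝ) H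
  | 0, _, _, _ => by simp [vEst]
  | n + 1, h, hn, s => by
    rw [vEst_succ_fst hn]
    exact payoff_mem_Icc (qUp_mem_Icc hD hβ (vEst_fst_mem_Icc hD hβ (by omega)) s) _ _

theorem vEst_snd_mem_Icc (hD : D.Valid G) (hβ : ∀ t, 0 ≤ β t) : ∀ {n h : ℕ}, h + n = H →
    ∀ s, (vEst H β nash D n h).2 s ∈ Set.Icc (0 : ℝ) n
  | 0, _, _, _ => by simp [vEst]
  | n + 1, h, hn, s => by
    rw [vEst_succ_snd hn]
    exact payoff_mem_Icc (qLow_mem_Icc hD hβ (vEst_snd_mem_Icc hD hβ (by omega)) s) _ _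

theorem vEst_snd_mem_Icc' (hD : D.Valid G) (hβ : ∀ t, 0 ≤ β t) {n h : ℕ} (hn : h + n = H)
    (s : S h) : (vEst H β nash D n h).2 s ∈ Set.Icc (0 : ℝ) H :=
  Set.Icc_subset_Icc_right (by exact_mod_cast (by omega : n ≤ H)) (vEst_snd_mem_Icc hD hβ hn s)

/-- The order of the estimates does not depend on accuracy. It places `V_up - V_low` in `[0, H]`,
where the total variation bound applies. -/
theorem vEst_snd_le_fst (hD : D.Valid G) (hβ : ∀ t, 0 ≤ β t) : ∀ {n h : ℕ}, h + n = H →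
    ∀ s, (vEst H β nash D n h).2 s ≤ (vEst H β nash D n h).1 s
  | 0, _, _, _ => by simp [vEst]
  | n + 1, h, hn, s => by
    rw [vEst_succ_fst hn, vEst_succ_snd hn]
    have hn' : h + 1 + n = H := by omega
    refine payoff_mono (fun a b => ?_) _ _
    have h1 := qLow_mem_Icc hD hβ (vEst_snd_mem_Icc (nash := nash) hD hβ hn') s a b
    have h2 := qUp_mem_Icc hD hβ (vEst_fst_mem_Icc (nash := nash) hD hβ hn') s a b
    by_cases hv : D.visits h s a b = 0
    · rw [qLow, if_pos hv]
      exact h2.1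
    · have h3 : ((n + 1 : ℕ) : ℝ) ≤ H := by exact_mod_cast (by omega : n + 1 ≤ H)
      rw [qUp, if_neg hv]
      refine le_min ?_ (h1.2.trans h3)
      have h4 := sum_phat_mul_mono D s a b (vEst_snd_le_fst hD hβ hn')
      have h5 := (hD.sum_phat_mul_mem_Icc hv (vEst_fst_mem_Icc (nash := nash) hD hβ hn')).1
      rw [qLow, if_neg hv]
      refine max_le (by linarith [hβ (D.visits h s a b)]) ?_
      rw [hD.rhat_eq h s a b hv]
      linarith [hβ (D.visits h s a b), (G.reward_mem h s a b).1]

/-- The upper estimate dominates the value of the min-player's policy against any opponent. -/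
theorem value_le_vEst_fst (hD : D.Valid G) (hacc : D.Accurate G H δ) (hβ0 : ∀ t, 0 ≤ β t)
    (hβ : ∀ t : ℕ, t ≠ 0 → H * (δ / √(t : ℝ)) ≤ β t) (hnash : nash.IsCorrect) (μ : Policy S A) :
    ∀ {n h : ℕ}, h + n = H → ∀ s, value G μ (fun h s => (plan H β nash D h s).2) n h s ≤
      (vEst H β nash D n h).1 s
  | 0, _, _, _ => by simp [value_zero, vEst]
  | n + 1, h, hn, s => by
    have hn' : h + 1 + n = H := by omega
    rw [value_succ, vEst_succ_fst hn]
    -- Against the deployed `ν` no deviation gains in the matrix `Q_up`; it remains to show that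
    -- `Q_up` dominates the true payoffs entrywise.
    refine le_trans (payoff_mono (fun a b => ?_) _ _) ((plan_isNash hnash hn s).1 (μ h s))
    have h2 : ∀ x, value G μ (fun h s => (plan H β nash D h s).2) n (h + 1) x ∈
        Set.Icc (0 : ℝ) n := fun x => value_mem_Icc G _ _ n (h + 1) x
    have h3 := G.reward_mem h s a b
    have h4 : ((n + 1 : ℕ) : ℝ) ≤ H := by exact_mod_cast (by omega : n + 1 ≤ H)
    have h5 := (sum_toReal_mul_mem_Icc (G.trans h s a b) h2).2
    push_cast at h4
    rw [qUp]
    split_ifs with hv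
    · linarith [h3.2]
    · refine le_min ?_ (by linarith [h3.2])
      have h6 := (abs_le.1 (hD.abs_sum_phat_sub_le hacc (by omega) hv
        (vEst_fst_mem_Icc (nash := nash) hD hβ0 hn'))).1
      have h7 := sum_toReal_mul_le (G.trans h s a b)
        (value_le_vEst_fst hD hacc hβ0 hβ hnash μ hn')
      rw [hD.rhat_eq h s a b hv]
      linarith [hβ _ hv]

/-- The lower estimate is dominated by the value of the max-player's policy against any
opponent. -/
theorem vEst_snd_le_value (hD : D.Valid G) (hacc : D.Accurate G H δ) (hβ0 : ∀ t, 0 ≤ β t)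
    (hβ : ∀ t : ℕ, t ≠ 0 → H * (δ / √(t : ℝ)) ≤ β t) (hnash : nash.IsCorrect) (ν : Policy S B) :
    ∀ {n h : ℕ}, h + n = H → ∀ s, (vEst H β nash D n h).2 s ≤
      value G (fun h s => (plan H β nash D h s).1) ν n h s
  | 0, _, _, _ => by simp [value_zero, vEst]
  | n + 1, h, hn, s => by
    have hn' : h + 1 + n = H := by omega
    rw [value_succ, vEst_succ_snd hn]
    refine le_trans ((plan_isNash hnash hn s).2 (ν h s)) (payoff_mono (fun a b => ?_) _ _)
    have h2 : ∀ x, value G (fun h s => (plan H β nash D h s).1) ν n (h + 1) x ∈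
        Set.Icc (0 : ℝ) n := fun x => value_mem_Icc G _ _ n (h + 1) x
    have h3 := G.reward_mem h s a b
    have h5 := (sum_toReal_mul_mem_Icc (G.trans h s a b) h2).1
    rw [qLow]
    split_ifs with hv
    · linarith [h3.1]
    · refine max_le ?_ (by linarith [h3.1])
      have h6 := (abs_le.1 (hD.abs_sum_phat_sub_le hacc (by omega) hv
        (vEst_snd_mem_Icc' (nash := nash) hD hβ0 hn'))).2
      have h7 := sum_toReal_mul_le (G.trans h s a b)
        (vEst_snd_le_value hD hacc hβ0 hβ hnash ν hn')
      rw [hD.rhat_eq h s a b hv]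
      linarith [hβ _ hv]

/-- The gap between the two estimates is at most `H` times the value of the deployed policies in
the game in which exploring is rewarded. -/
theorem vEst_fst_sub_snd_le (hD : D.Valid G) (hacc : D.Accurate G H δ) (hβ0 : ∀ t, 0 ≤ β t)
    (hl : 1 ≤ l) (hβl : ∀ t : ℕ, t ≠ 0 →
      2 * β t + H * (δ / √(t : ℝ)) ≤ H * (l / √((t : ℝ) + 1))) :
    ∀ {n h : ℕ}, h + n = H → ∀ s, (vEst H β nash D n h).1 s - (vEst H β nash D n h).2 s ≤
      H * value (exploreGame G l (zero_le_one.trans hl) D) (fun h s => (plan H β nash D h s).1)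
        (fun h s => (plan H β nash D h s).2) n h s
  | 0, _, _, _ => by simp [value_zero, vEst]
  | n + 1, h, hn, s => by
    have hn' : h + 1 + n = H := by omega
    rw [value_succ, vEst_succ_fst hn, vEst_succ_snd hn, payoff_sub, ← payoff_const_mul]
    refine payoff_mono (fun a b => ?_) _ _
    have hup := vEst_fst_mem_Icc (nash := nash) hD hβ0 hn'
    have hlow := vEst_snd_mem_Icc' (nash := nash) hD hβ0 hn'
    have hle := vEst_snd_le_fst (nash := nash) hD hβ0 hn'
    have ih := vEst_fst_sub_snd_le hD hacc hβ0 hl hβl hn'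
    set up := (vEst H β nash D n (h + 1)).1
    set low := (vEst H β nash D n (h + 1)).2
    set v := value (exploreGame G l (zero_le_one.trans hl) D)
      (fun h s => (plan H β nash D h s).1) (fun h s => (plan H β nash D h s).2) n (h + 1)
    have h1 := qUp_mem_Icc hD hβ0 hup s a b
    have h2 : 0 ≤ qLow β D h low s a b := by
      rw [qLow]
      split_ifs
      exacts [le_rfl, le_max_right _ _]
    have h3 : ∑ x, (G.trans h s a b x).toReal * (up x - low x) ≤
        H * ∑ x, (G.trans h s a b x).toReal * v x := by
      refine (sum_toReal_mul_le _ ih).trans_eq ?_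
      rw [Finset.mul_sum]
      exact Finset.sum_congr rfl fun x _ => by ring
    have h4 : 0 ≤ ∑ x, (G.trans h s a b x).toReal * (up x - low x) :=
      Finset.sum_nonneg fun x _ => mul_nonneg ENNReal.toReal_nonneg (sub_nonneg.2 (hle x))
    change _ ≤ H * (exploreReward l D h s a b + ∑ x, (G.trans h s a b x).toReal * v x)
    -- The alternative `1` of the minimum is covered by `Q_up - Q_low ≤ H`; only the other
    -- alternative uses accuracy.
    rw [mul_add, exploreReward, mul_min_of_nonneg _ _ (Nat.cast_nonneg H), mul_one,
      ← min_add_add_right]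
    refine le_min (by linarith [h1.2]) ?_
    by_cases hv : D.visits h s a b = 0
    · rw [hv, Nat.cast_zero, zero_add, Real.sqrt_one, div_one]
      have := mul_le_mul_of_nonneg_left hl (Nat.cast_nonneg H : (0 : ℝ) ≤ H)
      linarith [h1.2]
    · have h5 := (abs_le.1 (hD.abs_sum_phat_sub_le hacc (by omega) hv (f := fun x => up x - low x)
        fun x => ⟨sub_nonneg.2 (hle x), by linarith [(hup x).2, (hlow x).1]⟩)).2
      have h6 := hβl _ hv
      have h7 : qUp H β D h up s a b ≤
          D.rhat h s a b + ∑ s', D.phat h s a b s' * up s' + β (D.visits h s a b) := by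
        rw [qUp, if_neg hv]
        exact min_le_left _ _
      have h8 : D.rhat h s a b + ∑ s', D.phat h s a b s' * low s' - β (D.visits h s a b) ≤
          qLow β D h low s a b := by
        rw [qLow, if_neg hv]
        exact le_max_left _ _
      have h9 : ∑ x, D.phat h s a b x * (up x - low x) =
          ∑ x, D.phat h s a b x * up x - ∑ x, D.phat h s a b x * low x := by
        rw [← Finset.sum_sub_distrib]
        exact Finset.sum_congr rfl fun x _ => mul_sub _ _ _
      linarith

end Confidence

/-! ### Regret -/

theorem deviation_indicator {S : ℕ → Type u} {A : ℕ → Type v} {B : ℕ → Type w}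
    [∀ h, Fintype (S h)] (G : MarkovGame S A B) (D : Tables S A B)
    {h : ℕ} {s : S h} {a : A h} {b : B h} (hv : D.visits h s a b ≠ 0) (U : Finset (S (h + 1))) :
    D.deviation G h s a b ((U : Set (S (h + 1))).indicator 1) =
      D.visits h s a b * ∑ x ∈ U, (D.phat h s a b x - (G.trans h s a b x).toReal) := by
  classical
  have hv' : (D.visits h s a b : ℝ) ≠ 0 := Nat.cast_ne_zero.2 hv
  have h1 : ∀ f : S (h + 1) → ℝ,
      ∑ x, f x * (U : Set (S (h + 1))).indicator 1 x = ∑ x ∈ U, f x := by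
    intro f
    simp [Set.indicator_apply]
  rw [Tables.deviation, h1, h1, Finset.sum_sub_distrib, mul_sub]
  simp only [Tables.phat]
  rw [← Finset.sum_div, mul_div_cancel₀ _ hv']

section Regret

variable {S : ℕ → Type u} {A : ℕ → Type v} {B : ℕ → Type w}
  [∀ h, Fintype (S h)] [∀ h, Fintype (A h)] [∀ h, Fintype (B h)]
  (G : MarkovGame S A B) {H : ℕ} (β : ℕ → ℝ) (nash : History S A B H → Solver S A B)
  (adv : History S A B H → PMF (S 0))

/-- This crude bound settles the cases `ι > K` and `K H = 0`. -/
theorem regret_le_length_mul : ∀ hist : History S A B H, regret G β nash hist ≤ hist.length * H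
  | [] => by simp [regret]
  | e :: hist => by
    have h1 := regret_le_length_mul hist
    have : Nonempty (Policy S A) := ⟨maxPolicy G β nash hist⟩
    have : Nonempty (Policy S B) := ⟨minPolicy G β nash hist⟩
    have h2 : valueVsBestMax G (minPolicy G β nash hist) H 0 e.1 ≤ H :=
      ciSup_le fun μ => (value_mem_Icc G _ _ H 0 e.1).2
    have h3 : 0 ≤ valueVsBestMin G (maxPolicy G β nash hist) H 0 e.1 :=
      le_ciInf fun ν => (value_mem_Icc G _ _ H 0 e.1).1
    rw [regret, List.length_cons]
    push_cast
    linarith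

theorem regret_eq_zero_of_card_le_one (hA : ∀ h, h < H → Fintype.card (A h) ≤ 1)
    (hB : ∀ h, h < H → Fintype.card (B h) ≤ 1) :
    ∀ hist : History S A B H, regret G β nash hist = 0
  | [] => rfl
  | e :: hist => by
    have : Nonempty (Policy S A) := ⟨maxPolicy G β nash hist⟩
    have : Nonempty (Policy S B) := ⟨minPolicy G β nash hist⟩
    have h1 : ∀ μ ν, value G μ ν H 0 e.1 =
        value G (maxPolicy G β nash hist) (minPolicy G β nash hist) H 0 e.1 := fun μ ν =>
      value_eq_of_card_le_one G hA hB _ _ _ _ H 0 e.1 (by omega)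
    rw [regret, regret_eq_zero_of_card_le_one hA hB hist, valueVsBestMax, valueVsBestMin,
      iSup_congr fun μ => h1 μ _, iInf_congr fun ν => h1 _ ν, ciSup_const, ciInf_const]
    simp

/-- The sum over the episodes of the difference between the expected and the collected rewards
for exploring. -/
noncomputable def noise {l : ℝ} (hl : 0 ≤ l) : History S A B H → ℝ
  | [] => 0
  | e :: hist => noise hl hist +
      (value (exploreGame G l hl (tables G hist)) (maxPolicy G β nash hist)
        (minPolicy G β nash hist) H 0 e.1 -
          cumReward (exploreGame G l hl (tables G hist)) H 0 e.1 e.2)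

/-- Given the past, the increment of an episode is centred and bounded by `H`, because the
exploration rewards are capped at `1`. -/
theorem expect_exp_noise_le {l : ℝ} (hl : 0 ≤ l) {y : ℝ} (hy0 : 0 ≤ y) (hy : y * H ≤ 1) (k : ℕ) :
    expect (historyLaw G β nash adv k)
      (fun hist => ENNReal.ofReal (Real.exp (y * noise G β nash hl hist))) ≤
        ENNReal.ofReal (Real.exp ((y * H) ^ 2)) ^ k := by
  refine (expect_historyLaw_le G β nash adv _ (ENNReal.ofReal (Real.exp ((y * H) ^ 2)))
    (fun hist s => ?_) k).trans_eq (by simp [noise])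
  set G' := exploreGame G l hl (tables G hist) with hG'
  set μ := maxPolicy G β nash hist
  set ν := minPolicy G β nash hist
  have h1 : ∀ τ, ENNReal.ofReal (Real.exp (y * noise G β nash hl ((s, τ) :: hist))) =
      ENNReal.ofReal (Real.exp (y * (value G' μ ν H 0 s - cumReward G' H 0 s τ))) *
        ENNReal.ofReal (Real.exp (y * noise G β nash hl hist)) := by
    intro τ
    rw [← ENNReal.ofReal_mul (Real.exp_pos _).le, ← Real.exp_add, noise, ← mul_add, add_comm]
  simp only [h1, expect_mul_right]
  rw [mul_comm]
  refine mul_le_mul_right (expect_exp_le _ hy (fun τ => ?_) ?_) _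
  · rw [abs_mul, abs_of_nonneg hy0]
    have h2 := value_mem_Icc G' μ ν H 0 s
    have h3 := cumReward_mem_Icc G' H 0 s τ
    exact mul_le_mul_of_nonneg_left
      (abs_le.2 ⟨by linarith [h2.1, h3.2], by linarith [h2.2, h3.1]⟩) hy0
  · have h2 : ∑ τ, (rollout G μ ν H 0 s τ).toReal * cumReward G' H 0 s τ = value G' μ ν H 0 s := by
      rw [value, hG', exploreGame, rollout_withReward]
    calc ∑ τ, (rollout G μ ν H 0 s τ).toReal * (y * (value G' μ ν H 0 s - cumReward G' H 0 s τ))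
        = y * (∑ τ, (rollout G μ ν H 0 s τ).toReal * value G' μ ν H 0 s -
            ∑ τ, (rollout G μ ν H 0 s τ).toReal * cumReward G' H 0 s τ) := by
          rw [← Finset.sum_sub_distrib, Finset.mul_sum]
          exact Finset.sum_congr rfl fun τ _ => by ring
      _ = 0 := by rw [sum_toReal_mul_const, h2, sub_self, mul_zero]

/-- As long as the estimates are accurate, the regret is controlled by the rewards collected for
exploring. -/
theorem regret_le_of_accurate {δ l : ℝ} (hl : 1 ≤ l) (hβ0 : ∀ t, 0 ≤ β t)
    (hβ : ∀ t : ℕ, t ≠ 0 → H * (δ / √(t : ℝ)) ≤ β t)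
    (hβl : ∀ t : ℕ, t ≠ 0 → 2 * β t + H * (δ / √(t : ℝ)) ≤ H * (l / √((t : ℝ) + 1)))
    (hnash : ∀ hist, (nash hist).IsCorrect) :
    ∀ hist : History S A B H, AllPrefixes (fun h => (tables G h).Accurate G H δ) hist →
      regret G β nash hist ≤ H * (noise G β nash (zero_le_one.trans hl) hist +
        l * (tables G hist).potential H)
  | [], _ => by simp [regret, noise, tables, Tables.potential, Tables.sumVisits, Tables.init]
  | e :: hist, hacc => by
    have ih := regret_le_of_accurate hl hβ0 hβ hβl hnash hist hacc.1
    have hD := tables_valid G hist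
    have : Nonempty (Policy S A) := ⟨maxPolicy G β nash hist⟩
    have : Nonempty (Policy S B) := ⟨minPolicy G β nash hist⟩
    have h1 : valueVsBestMax G (minPolicy G β nash hist) H 0 e.1 ≤
        (vEst H β (nash hist) (tables G hist) H 0).1 e.1 := ciSup_le fun μ =>
      value_le_vEst_fst hD hacc.2 hβ0 hβ (hnash hist) μ (zero_add H) e.1
    have h2 : (vEst H β (nash hist) (tables G hist) H 0).2 e.1 ≤
        valueVsBestMin G (maxPolicy G β nash hist) H 0 e.1 := le_ciInf fun ν =>
      vEst_snd_le_value hD hacc.2 hβ0 hβ (hnash hist) ν (zero_add H) e.1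
    have h3 := vEst_fst_sub_snd_le (nash := nash hist) hD hacc.2 hβ0 hl hβl (zero_add H) e.1
    have h4 := cumReward_exploreGame_le G (zero_le_one.trans hl) (tables G hist) (H := H) H 0 e.1
      e.2 (tables G hist) (by omega) fun _ _ => rfl
    have h5 := mul_le_mul_of_nonneg_left h4 (Nat.cast_nonneg H : (0 : ℝ) ≤ H)
    rw [regret, noise, tables]
    change _ ≤ H * (noise G β nash (zero_le_one.trans hl) hist +
      (value _ (fun h s => (plan H β (nash hist) (tables G hist) h s).1)
        (fun h s => (plan H β (nash hist) (tables G hist) h s).2) H 0 e.1 - _) + _)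
    simp only [mul_sub, mul_add] at *
    linarith

theorem le_sum_of_mem {ι : Type*} {I : Finset ι} {f : ι → ℝ≥0∞} {c : ℝ≥0∞} {i : ι} (hi : i ∈ I)
    (h : c ≤ f i) : c ≤ ∑ i ∈ I, f i :=
  h.trans (Finset.single_le_sum (fun _ _ => zero_le) hi)

theorem sum_le_natCast_mul {ι : Type*} {I : Finset ι} {f : ι → ℝ≥0∞} {c : ℝ≥0∞} {m : ℕ}
    (hm : I.card ≤ m) (h : ∀ i ∈ I, f i ≤ c) : ∑ i ∈ I, f i ≤ m * c := by
  refine (Finset.sum_le_card_nsmul I f c h).trans ?_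
  rw [nsmul_eq_mul]
  gcongr

/-- The estimates of a given episode are accurate with high probability. -/
theorem toOuterMeasure_not_accurate_le {nS nA nB : ℕ} (hS : ∀ h, h ≤ H → Fintype.card (S h) ≤ nS)
    (hA : ∀ h, h < H → Fintype.card (A h) ≤ nA) (hB : ∀ h, h < H → Fintype.card (B h) ≤ nB)
    {x : ℝ} (hx : 0 ≤ x) {k K : ℕ} (hk : k ≤ K) :
    (historyLaw G β nash adv k).toOuterMeasure
      {hist | ¬ (tables G hist).Accurate G H (6 * √x)} ≤
        ((H * ((nS * (nA * nB)) * (2 ^ nS * K)) : ℕ) : ℝ≥0∞) *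
          ENNReal.ofReal (Real.exp (-(5 * x))) := by
  classical
  set ε := ENNReal.ofReal (Real.exp (-(5 * x))) with hε
  -- One weight for each possible value `t` of the random count, with parameter `√(x / t)` tuned to
  -- it. The guard keeps the parameter in the range where the supermartingale bound holds.
  let F : ∀ h : ℕ, S h × A h × B h → Finset (S (h + 1)) → ℕ → History S A B H → ℝ≥0∞ :=
    fun h z U t hist => if √(x / t) ≤ 1 then
      (tables G hist).weight G h z.1 z.2.1 z.2.2 ((U : Set (S (h + 1))).indicator 1) (√(x / t)) * ε
      else 0
  have hF : ∀ h z U t, expect (historyLaw G β nash adv k) (F h z U t) ≤ ε := by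
    intro h z U t
    by_cases ht : √(x / t) ≤ 1
    · simp only [F, if_pos ht, expect_mul_right]
      refine mul_le_of_le_one_left zero_le ?_
      refine expect_weight_tables_le G β nash adv _ _ _ (fun y => ?_) (Real.sqrt_nonneg _) ht k
      by_cases hy : y ∈ U <;> simp [hy]
    · simp only [F, if_neg ht]
      exact (expect_const _ _).trans_le zero_le
  calc _ ≤ expect (historyLaw G β nash adv k) (fun hist =>
        ∑ h ∈ Finset.range H, ∑ z, ∑ U, ∑ t ∈ Finset.Icc 1 K, F h z U t hist) := by
        refine toOuterMeasure_le_expect _ fun hist hbad hne => ?_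
        have hlen := length_of_historyLaw_ne_zero G β nash adv k hist hne
        simp only [Set.mem_ofPred_eq, Tables.Accurate, not_forall, not_le] at hbad
        obtain ⟨h, hh, s, a, b, hv, U, hU⟩ := hbad
        set D := tables G hist
        have hvK : D.visits h s a b ≤ K := (visits_tables_le G hist h s a b).trans (by omega)
        have ht0 : (0 : ℝ) < D.visits h s a b := Nat.cast_pos.2 (Nat.pos_of_ne_zero hv)
        refine le_sum_of_mem (Finset.mem_range.2 hh) (le_sum_of_mem (Finset.mem_univ (s, a, b))
          (le_sum_of_mem (Finset.mem_univ U) (le_sum_of_mem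
            (Finset.mem_Icc.2 ⟨Nat.pos_of_ne_zero hv, hvK⟩) ?_)))
        set t : ℝ := (D.visits h s a b : ℝ)
        have hst : 0 < √t := Real.sqrt_pos.2 ht0
        -- Otherwise the radius `6 √x / √t` exceeds `1`, and no difference of probabilities is that
        -- large.
        have hle : √(x / t) ≤ 1 := by
          by_contra hcon
          rw [not_le, Real.sqrt_div hx, lt_div_iff₀ hst, one_mul] at hcon
          have h1 : ∑ x ∈ U, (D.phat h s a b x - (G.trans h s a b x).toReal) ≤ 1 := by
            rw [← (tables_valid G hist).sum_phat hv]
            refine (Finset.sum_le_sum fun x _ => sub_le_self _ ENNReal.toReal_nonneg).trans ?_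
            exact Finset.sum_le_univ_sum_of_nonneg fun x => D.phat_nonneg h s a b x
          have h2 : 1 ≤ 6 * √x / √t := by
            rw [le_div_iff₀ hst]
            linarith
          linarith
        simp only [F]
        rw [if_pos hle, Tables.weight, deviation_indicator G D hv, hε,
          ← ENNReal.ofReal_mul (Real.exp_pos _).le, ← Real.exp_add, ENNReal.one_le_ofReal,
          Real.one_le_exp_iff]
        -- With `λ = √(x / t)` the exponent `λ · deviation - λ² t` is at least `6 x - x = 5 x`,
        -- which cancels `ε`.
        have h3 : √(x / t) * (t * (6 * √x / √t)) = 6 * x := by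
          rw [Real.sqrt_div hx]
          field_simp
          rw [Real.sq_sqrt hx, Real.sq_sqrt ht0.le, mul_comm]
        have h4 : √(x / t) ^ 2 * t = x := by
          rw [Real.sq_sqrt (by positivity)]
          field_simp
        have h5 := mul_le_mul_of_nonneg_left (mul_le_mul_of_nonneg_left hU.le ht0.le)
          (Real.sqrt_nonneg (x / t))
        linarith
    _ ≤ _ := by
        simp only [expect_sum]
        simp only [Nat.cast_mul, mul_assoc]
        refine sum_le_natCast_mul (Finset.card_range H).le fun h hh => ?_
        have hh' := Finset.mem_range.1 hh
        rw [← mul_assoc (nA : ℝ≥0∞), ← mul_assoc (nS : ℝ≥0∞), ← Nat.cast_mul, ← Nat.cast_mul]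
        refine sum_le_natCast_mul ?_ fun z _ => ?_
        · rw [Finset.card_univ, Fintype.card_prod, Fintype.card_prod]
          exact Nat.mul_le_mul (hS h hh'.le) (Nat.mul_le_mul (hA h hh') (hB h hh'))
        refine sum_le_natCast_mul ?_ fun U _ => ?_
        · rw [Finset.card_univ, Fintype.card_finset]
          exact Nat.pow_le_pow_right two_pos (hS (h + 1) hh')
        · exact sum_le_natCast_mul (by simp) fun t _ => hF h z U t

end Regret

/-! ### Size of the bonus -/

section Bonus

theorem bonus_eq (c : ℝ) (H nS : ℕ) (ι : ℝ) (t : ℕ) :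
    bonus c H nS ι t = c * (H * (√(nS * ι) / √t)) := by
  rw [bonus, mul_assoc, mul_div_assoc, Real.sqrt_mul (by positivity),
    Real.sqrt_sq (Nat.cast_nonneg _), Real.sqrt_div' _ (Nat.cast_nonneg _)]

theorem bonus_nonneg {c : ℝ} (hc : 0 ≤ c) (H nS : ℕ) (ι : ℝ) (t : ℕ) : 0 ≤ bonus c H nS ι t :=
  mul_nonneg hc (Real.sqrt_nonneg _)

theorem le_bonus {c : ℝ} (hc : 6 ≤ c) (H nS : ℕ) (ι : ℝ) (t : ℕ) :
    H * (6 * √(nS * ι) / √(t : ℝ)) ≤ bonus c H nS ι t := by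
  rw [bonus_eq, mul_div_assoc, mul_left_comm]
  exact mul_le_mul_of_nonneg_right hc (by positivity)

/-- The estimation error is at most one more bonus, which makes three, and `√(t + 1) ≤ 2 √t` for `t
≥ 1`; hence the factor `6 c`. -/
theorem two_mul_bonus_add_le {c : ℝ} (hc : 6 ≤ c) (H nS : ℕ) (ι : ℝ) {t : ℕ} (ht : t ≠ 0) :
    2 * bonus c H nS ι t + H * (6 * √(nS * ι) / √(t : ℝ)) ≤
      H * (6 * c * √(nS * ι) / √((t : ℝ) + 1)) := by
  have h1 : (1 : ℝ) ≤ t := by exact_mod_cast Nat.pos_of_ne_zero ht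
  have h2 : √((t : ℝ) + 1) ≤ 2 * √(t : ℝ) := by
    rw [Real.sqrt_le_left (by positivity), mul_pow, Real.sq_sqrt (by positivity)]
    linarith
  have h3 : 0 < √(t : ℝ) := Real.sqrt_pos.2 (by linarith)
  have h4 : 0 < √((t : ℝ) + 1) := Real.sqrt_pos.2 (by linarith)
  have h5 : √(nS * ι) / √(t : ℝ) ≤ 2 * (√(nS * ι) / √((t : ℝ) + 1)) := by
    rw [← mul_div_assoc, div_le_div_iff₀ h3 h4]
    nlinarith [Real.sqrt_nonneg (nS * ι)]
  have h6 := mul_le_mul_of_nonneg_left h5 (show (0 : ℝ) ≤ 3 * c * H by positivity)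
  have h7 := le_bonus hc H nS ι t
  have h8 := bonus_eq c H nS ι t
  calc _ ≤ 3 * bonus c H nS ι t := by linarith
    _ = 3 * c * H * (√(nS * ι) / √(t : ℝ)) := by rw [h8]; ring
    _ ≤ _ := h6
    _ = _ := by ring

end Bonus

/-! ### The logarithmic factor and failure probabilities -/

section LogFactor

theorem logFactor_nonneg (nS nA nB K H : ℕ) {p : ℝ} (hp0 : 0 < p) (hp1 : p < 1) :
    0 ≤ logFactor nS nA nB K H p := by
  have h : logFactor nS nA nB K H p = Real.log ((nS * nA * nB * (K * H) : ℕ) / p) := by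
    simp [logFactor]
  rw [h]
  rcases Nat.eq_zero_or_pos (nS * nA * nB * (K * H)) with h0 | h0
  · simp [h0]
  · refine Real.log_nonneg ?_
    rw [le_div_iff₀ hp0, one_mul]
    have : (1 : ℝ) ≤ (nS * nA * nB * (K * H) : ℕ) := by exact_mod_cast h0
    linarith

theorem exp_neg_logFactor {nS nA nB K H : ℕ} {p : ℝ} (hp0 : 0 < p)
    (hN : 0 < nS * nA * nB * (K * H)) :
    Real.exp (-logFactor nS nA nB K H p) = p / (nS * nA * nB * (K * H) : ℕ) := by
  have hN' : (0 : ℝ) < (nS * nA * nB * (K * H) : ℕ) := by exact_mod_cast hN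
  rw [logFactor, Real.exp_neg, Real.exp_log, inv_div]
  · push_cast
    rfl
  · push_cast at hN'
    positivity

theorem exp_neg_two_mul_logFactor_le {nS nA nB K H : ℕ} {p : ℝ} (hp0 : 0 < p) (hp1 : p < 1)
    (hN : 2 ≤ nS * nA * nB * (K * H)) :
    Real.exp (-(2 * logFactor nS nA nB K H p)) ≤ p / 2 := by
  have h1 := exp_neg_logFactor (p := p) hp0 (by omega : 0 < nS * nA * nB * (K * H))
  have h2 : (2 : ℝ) ≤ (nS * nA * nB * (K * H) : ℕ) := by exact_mod_cast hN
  have h3 : p / (nS * nA * nB * (K * H) : ℕ) ≤ p / 2 :=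
    div_le_div_of_nonneg_left hp0.le two_pos h2
  have h4 : -(2 * logFactor nS nA nB K H p) =
      -logFactor nS nA nB K H p + -logFactor nS nA nB K H p := by ring
  rw [h4, Real.exp_add, h1]
  have h5 : 0 ≤ p / (nS * nA * nB * (K * H) : ℕ) := by positivity
  nlinarith

theorem log_two_le_logFactor {nS nA nB K H : ℕ} {p : ℝ} (hp0 : 0 < p) (hp1 : p < 1)
    (hN : 2 ≤ nS * nA * nB * (K * H)) : Real.log 2 ≤ logFactor nS nA nB K H p := by
  have h2 : (2 : ℝ) ≤ (nS * nA * nB * (K * H) : ℕ) := by exact_mod_cast hN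
  push_cast at h2
  refine Real.log_le_log two_pos ?_
  rw [le_div_iff₀ hp0]
  linarith

/-- The total failure probability of the union bound over steps, states, actions, sets of
successors, visit counts and episodes. -/
theorem union_bound_le {nS nA nB K H : ℕ} {p : ℝ} (hp0 : 0 < p) (hp1 : p < 1)
    (hN : 2 ≤ nS * nA * nB * (K * H)) :
    ((K * (H * ((nS * (nA * nB)) * (2 ^ nS * K))) : ℕ) : ℝ) *
      Real.exp (-(5 * (nS * logFactor nS nA nB K H p))) ≤ p / 2 := by
  set ι := logFactor nS nA nB K H p with hι
  set N := nS * nA * nB * (K * H) with hNdef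
  have hN' : (0 : ℝ) < N := by exact_mod_cast (by omega : 0 < N)
  have hne : nS * nA * nB * (K * H) ≠ 0 := by omega
  have hS1 : 1 ≤ nS := by
    by_contra h0
    simp [show nS = 0 by omega] at hne
  have hpos : 0 < nS * nA * nB * H := by
    refine Nat.pos_of_ne_zero fun h0 => hne ?_
    rw [show nS * nA * nB * (K * H) = nS * nA * nB * H * K by ring, h0, zero_mul]
  have hKN : K ≤ N := by
    rw [hNdef, show nS * nA * nB * (K * H) = nS * nA * nB * H * K by ring]
    exact Nat.le_mul_of_pos_left K hpos
  have hι2 := log_two_le_logFactor hp0 hp1 hN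
  rw [← hι] at hι2
  have hι0 : 0 ≤ ι := (Real.log_nonneg one_le_two).trans hι2
  have hE := exp_neg_logFactor (p := p) hp0 (by omega : 0 < nS * nA * nB * (K * H))
  rw [← hι, ← hNdef] at hE
  have hNE : (N : ℝ) ≤ Real.exp ι := by
    rw [← inv_inv (Real.exp ι), ← Real.exp_neg, hE, inv_div, le_div_iff₀ hp0]
    nlinarith
  have h2E : (2 : ℝ) ^ nS ≤ Real.exp (nS * ι) := by
    rw [Real.exp_nat_mul]
    refine pow_le_pow_left₀ zero_le_two ?_ nS
    rw [← Real.exp_log two_pos]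
    exact Real.exp_le_exp.2 hι2
  -- The number of events is `K N 2 ^ nS` with `K ≤ N ≤ exp ι` and `2 ≤ exp ι`. Since `nS ≥ 1`, the
  -- total exponent is `2 ι + nS ι - 5 nS ι ≤ -2 ι`.
  have h1 : ((K * (H * ((nS * (nA * nB)) * (2 ^ nS * K))) : ℕ) : ℝ) ≤
      Real.exp ι * Real.exp ι * Real.exp (nS * ι) := by
    have e1 : K * (H * ((nS * (nA * nB)) * (2 ^ nS * K))) = K * N * 2 ^ nS := by
      rw [hNdef]
      ring
    rw [e1]
    push_cast
    have : (K : ℝ) ≤ N := by exact_mod_cast hKN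
    gcongr
    exact this.trans hNE
  refine le_trans ?_ (exp_neg_two_mul_logFactor_le hp0 hp1 hN)
  refine (mul_le_mul_of_nonneg_right h1 (Real.exp_pos _).le).trans ?_
  rw [← Real.exp_add, ← Real.exp_add, ← Real.exp_add]
  refine Real.exp_le_exp.2 ?_
  have : ι ≤ nS * ι := le_mul_of_one_le_left hι0 (by exact_mod_cast hS1)
  linarith

end LogFactor

/-! ### Assembling the regret bound -/

section Bound

variable {S : ℕ → Type u} {A : ℕ → Type v} {B : ℕ → Type w}
  [∀ h, Fintype (S h)] [∀ h, Fintype (A h)] [∀ h, Fintype (B h)]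

theorem maxActionPairs_le {H nA nB : ℕ} (hA : ∀ h, h < H → Fintype.card (A h) ≤ nA)
    (hB : ∀ h, h < H → Fintype.card (B h) ≤ nB) : maxActionPairs A B H ≤ nA * nB :=
  Finset.sup_le fun h hh =>
    Nat.mul_le_mul (hA h (Finset.mem_range.1 hh)) (hB h (Finset.mem_range.1 hh))

theorem one_le_maxActionPairs [∀ h, Nonempty (A h)] [∀ h, Nonempty (B h)] {H : ℕ} (hH : 0 < H) :
    1 ≤ maxActionPairs A B H :=
  (Nat.mul_pos Fintype.card_pos Fintype.card_pos :
      0 < Fintype.card (A 0) * Fintype.card (B 0)).trans_le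
    (Finset.le_sup (f := fun h => Fintype.card (A h) * Fintype.card (B h))
      (Finset.mem_range.2 hH))

theorem sqrt_regret_bound_eq (H K nS M : ℕ) (ι : ℝ) :
    √((H : ℝ) ^ 3 * nS ^ 2 * M * (K * H) * ι) = H ^ 2 * nS * √(M * (K * ι)) := by
  have h1 : (H : ℝ) ^ 3 * nS ^ 2 * M * (K * H) * ι = (H ^ 2 * nS) ^ 2 * (M * (K * ι)) := by ring
  rw [h1, Real.sqrt_mul (by positivity), Real.sqrt_sq (by positivity)]

theorem sqrt_le_regret_bound {H K nS M : ℕ} {ι : ℝ} (hι : 0 ≤ ι) (hS : 1 ≤ nS) (hM : 1 ≤ M) :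
    (H : ℝ) ^ 2 * √(K * ι) ≤ H ^ 2 * nS * √(M * (K * ι)) := by
  have hS' : (1 : ℝ) ≤ nS := by exact_mod_cast hS
  have hM' : (1 : ℝ) ≤ M := by exact_mod_cast hM
  have h1 : √(K * ι) ≤ √(M * (K * ι)) :=
    Real.sqrt_le_sqrt (le_mul_of_one_le_left (by positivity) hM')
  rw [mul_assoc]
  refine mul_le_mul_of_nonneg_left (h1.trans ?_) (by positivity)
  exact le_mul_of_one_le_left (Real.sqrt_nonneg _) hS'

variable (G : MarkovGame S A B) {H : ℕ} (nash : History S A B H → Solver S A B)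
  (adv : History S A B H → PMF (S 0))

/-- An Azuma-type bound: with `y H = √(ι / K)` the moment generating function is at most `exp ι`,
and at the threshold Markov's inequality gains `exp (-3 ι)`. The condition `ι ≤ K` gives `y H ≤ 1`.
-/
theorem noise_concentration (β : ℕ → ℝ) {l : ℝ} (hl : 0 ≤ l) (hH : 0 < H) {K : ℕ} (hK : 0 < K)
    {ι : ℝ} (hι : 0 ≤ ι) (hιK : ι ≤ K) :
    (historyLaw G β nash adv K).toOuterMeasure
      {hist | 3 * (H * √(K * ι)) < noise G β nash hl hist} ≤
        ENNReal.ofReal (Real.exp (-(2 * ι))) := by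
  have hK' : (0 : ℝ) < K := by exact_mod_cast hK
  have hH' : (0 : ℝ) < H := by exact_mod_cast hH
  set y : ℝ := √(ι / K) / H with hy
  have hy0 : 0 ≤ y := by positivity
  have hyH : y * H = √(ι / K) := by
    rw [hy]
    field_simp
  have hy1 : y * H ≤ 1 := by
    rw [hyH, Real.sqrt_le_one]
    rwa [div_le_one hK']
  have h1 := expect_exp_noise_le G β nash adv hl hy0 hy1 K
  have hmul : y * (3 * (H * √(K * ι))) = 3 * ι := by
    have e1 : √(ι / K) * √(K * ι) = ι := by
      rw [← Real.sqrt_mul (by positivity), show ι / K * (K * ι) = ι ^ 2 by field_simp,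
        Real.sqrt_sq hι]
    calc y * (3 * (H * √(K * ι))) = 3 * ((y * H) * √(K * ι)) := by ring
      _ = 3 * ι := by rw [hyH, e1]
  calc _ ≤ expect (historyLaw G β nash adv K) (fun hist =>
        ENNReal.ofReal (Real.exp (y * noise G β nash hl hist)) *
          ENNReal.ofReal (Real.exp (-(3 * ι)))) := by
        refine toOuterMeasure_le_expect _ fun hist hbad _ => ?_
        rw [← ENNReal.ofReal_mul (Real.exp_pos _).le, ← Real.exp_add, ENNReal.one_le_ofReal,
          Real.one_le_exp_iff]
        have := mul_le_mul_of_nonneg_left (le_of_lt hbad) hy0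
        linarith
    _ ≤ ENNReal.ofReal (Real.exp ι) * ENNReal.ofReal (Real.exp (-(3 * ι))) := by
        rw [expect_mul_right]
        refine mul_le_mul_left (h1.trans_eq ?_) _
        rw [hyH, Real.sq_sqrt (by positivity), ← ENNReal.ofReal_pow (Real.exp_pos _).le,
          ← Real.exp_nat_mul, mul_div_cancel₀ _ hK'.ne']
    _ = _ := by
        rw [← ENNReal.ofReal_mul (Real.exp_pos _).le, ← Real.exp_add]
        congr 2
        ring

/-- The regret bound when `ι` is bounded below by `log 2`. -/
theorem regret_bound_of_two_le [∀ h, Nonempty (A h)] [∀ h, Nonempty (B h)] {c : ℝ} (hc : 6 ≤ c)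
    {K nS nA nB : ℕ} (hS : ∀ h, h ≤ H → Fintype.card (S h) ≤ nS)
    (hA : ∀ h, h < H → Fintype.card (A h) ≤ nA) (hB : ∀ h, h < H → Fintype.card (B h) ≤ nB)
    (hnash : ∀ hist, (nash hist).IsCorrect) {p : ℝ} (hp0 : 0 < p) (hp1 : p < 1)
    (hN : 2 ≤ nS * nA * nB * (K * H)) {ι : ℝ} (hι : ι = logFactor nS nA nB K H p) :
    ENNReal.ofReal (1 - p) ≤ (historyLaw G (bonus c H nS ι) nash adv K).toOuterMeasure
      {hist | regret G (bonus c H nS ι) nash hist ≤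
        (12 * c + 3) * (H ^ 2 * nS * √(maxActionPairs A B H * (K * ι)))} := by
  have hne : nS * nA * nB * (K * H) ≠ 0 := by omega
  simp only [mul_ne_zero_iff] at hne
  obtain ⟨⟨⟨hS0, -⟩, -⟩, hK0, hH0⟩ := hne
  have hS1 : 1 ≤ nS := Nat.pos_of_ne_zero hS0
  have hH1 : (1 : ℝ) ≤ H := by exact_mod_cast Nat.pos_of_ne_zero hH0
  have hM1 := one_le_maxActionPairs (A := A) (B := B) (Nat.pos_of_ne_zero hH0)
  have hι2 : Real.log 2 ≤ ι := hι ▸ log_two_le_logFactor hp0 hp1 hN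
  have hιq : 1 / 4 ≤ ι := by linarith [Real.log_two_gt_d9]
  have hι0 : 0 ≤ ι := by linarith
  set β := bonus c H nS ι
  set M := maxActionPairs A B H
  set R : ℝ := H ^ 2 * nS * √(M * (K * ι)) with hR
  have hR0 : 0 ≤ R := by positivity
  have hKR : (H : ℝ) ^ 2 * √(K * ι) ≤ R := sqrt_le_regret_bound hι0 hS1 hM1
  -- For `K < ι` one has `K ≤ √(K ι)`, so the trivial bound `K H` is enough and no bad event is
  -- needed.
  by_cases hιK : (K : ℝ) < ι
  · refine ofReal_one_sub_le_toOuterMeasure _ (t := ∅) hp0.le (by simp) fun hist hne _ => ?_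
    have h1 := regret_le_length_mul G β nash hist
    rw [length_of_historyLaw_ne_zero G β nash adv K hist hne] at h1
    have h2 : (K : ℝ) ≤ √(K * ι) := Real.le_sqrt_of_sq_le (by nlinarith)
    have h3 : (K : ℝ) * H ≤ H ^ 2 * √(K * ι) := by
      nlinarith [mul_le_mul_of_nonneg_left h2 (sq_nonneg (H : ℝ)),
        mul_nonneg (Nat.cast_nonneg K : (0 : ℝ) ≤ K) (mul_nonneg (by linarith : (0 : ℝ) ≤ H)
          (sub_nonneg.2 hH1))]
    change regret G β nash hist ≤ (12 * c + 3) * R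
    nlinarith
  · rw [not_lt] at hιK
    set x : ℝ := nS * ι with hx
    have hS1' : (1 : ℝ) ≤ nS := by exact_mod_cast hS1
    have hxι : ι ≤ x := le_mul_of_one_le_left hι0 hS1'
    have hx0 : 0 ≤ x := hι0.trans hxι
    have hsx : 1 / 2 ≤ √x := Real.le_sqrt_of_sq_le (by linarith)
    have hl : 1 ≤ 6 * c * √x := by nlinarith
    have hl0 : 0 ≤ 6 * c * √x := zero_le_one.trans hl
    -- Two bad events, each of probability at most `p / 2`: inaccurate tables before some episode,
    -- and large noise.
    refine ofReal_one_sub_le_toOuterMeasure _ (t := {hist |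
      ¬ AllPrefixes (fun h => (tables G h).Accurate G H (6 * √x)) hist} ∪
        {hist | 3 * (H * √(K * ι)) < noise G β nash hl0 hist}) hp0.le ?_ fun hist hne hgood => ?_
    · refine (MeasureTheory.measure_union_le _ _).trans ?_
      rw [show p = p / 2 + p / 2 by ring, ENNReal.ofReal_add (by linarith) (by linarith)]
      refine add_le_add ?_ ?_
      · refine (toOuterMeasure_not_allPrefixes_le G β nash adv _ _ K fun j hj =>
          toOuterMeasure_not_accurate_le G β nash adv hS hA hB hx0 hj.le).trans ?_
        rw [← mul_assoc, ← Nat.cast_mul, ← ENNReal.ofReal_natCast,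
          ← ENNReal.ofReal_mul (Nat.cast_nonneg _), hx, hι]
        exact ENNReal.ofReal_le_ofReal (union_bound_le hp0 hp1 hN)
      · refine (noise_concentration G nash adv β hl0 (Nat.pos_of_ne_zero hH0)
          (Nat.pos_of_ne_zero hK0) hι0 hιK).trans ?_
        rw [hι]
        exact ENNReal.ofReal_le_ofReal (exp_neg_two_mul_logFactor_le hp0 hp1 hN)
    · simp only [Set.mem_union, Set.mem_ofPred_eq, not_or, not_not, not_lt] at hgood
      have h1 := regret_le_of_accurate G β nash hl (bonus_nonneg (by linarith) H nS ι)
        (fun t _ => le_bonus hc H nS ι t) (fun t ht => two_mul_bonus_add_le hc H nS ι ht)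
        hnash hist hgood.1
      have h2 := potential_tables_le G hS hist
      rw [length_of_historyLaw_ne_zero G β nash adv K hist hne] at h2
      have h3 : √x * √(nS * M * K) = nS * √(M * (K * ι)) := by
        rw [← Real.sqrt_mul hx0, hx,
          show nS * ι * (nS * M * K) = (nS : ℝ) ^ 2 * (M * (K * ι)) by ring,
          Real.sqrt_mul (by positivity), Real.sqrt_sq (by positivity)]
      change regret G β nash hist ≤ (12 * c + 3) * R
      calc regret G β nash hist ≤ _ := h1
        _ ≤ H * (3 * (H * √(K * ι)) + 6 * c * √x * (H * (2 * √(nS * M * K)))) := by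
            gcongr
            exact hgood.2
        _ = 3 * (H ^ 2 * √(K * ι)) + 12 * c * (H ^ 2 * (√x * √(nS * M * K))) := by ring
        _ = 3 * (H ^ 2 * √(K * ι)) + 12 * c * R := by rw [h3, hR]; ring
        _ ≤ (12 * c + 3) * R := by linarith

end Bound

end ZeroSumMG

theorem theorem1 :
    ∃ c₀ : ℝ, 0 < c₀ ∧ ∀ c : ℝ, c₀ ≤ c → ∃ C : ℝ, 0 < C ∧
      ∀ (S : ℕ → Type*) (A : ℕ → Type*) (B : ℕ → Type*)
        [∀ h, Fintype (S h)] [∀ h, Fintype (A h)] [∀ h, Fintype (B h)]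
        [∀ h, Nonempty (A h)] [∀ h, Nonempty (B h)]
        (G : ZeroSumMG.MarkovGame S A B)
        (H K nS nA nB : ℕ),
        (∀ h, h ≤ H → Fintype.card (S h) ≤ nS) →
        (∀ h, h < H → Fintype.card (A h) ≤ nA) →
        (∀ h, h < H → Fintype.card (B h) ≤ nB) →
        ∀ (adv : ZeroSumMG.History S A B H → PMF (S 0))
          (nash : ZeroSumMG.History S A B H → ZeroSumMG.Solver S A B),
        (∀ hist, (nash hist).IsCorrect) →
        ∀ p : ℝ, 0 < p → p < 1 →
        let ι : ℝ := ZeroSumMG.logFactor nS nA nB K H p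
        let β : ℕ → ℝ := ZeroSumMG.bonus c H nS ι
        let T : ℝ := K * H
        ENNReal.ofReal (1 - p) ≤
            (ZeroSumMG.historyLaw G β nash adv K).toOuterMeasure
              {hist | ZeroSumMG.regret G β nash hist ≤
                C * √((H : ℝ) ^ 3 * nS ^ 2 * ZeroSumMG.maxActionPairs A B H * T * ι)} ∧
          C * √((H : ℝ) ^ 3 * nS ^ 2 * ZeroSumMG.maxActionPairs A B H * T * ι) ≤
            C * √((H : ℝ) ^ 3 * nS ^ 2 * ((nA : ℝ) * nB) * T * ι) := by
  -- The `6` is the constant in the accuracy radius. In `12 c + 3`, the factor `6 c` of `l` meets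
  -- the `2` of the potential, and `3` comes from the noise.
  refine ⟨6, by norm_num, fun c hc => ⟨12 * c + 3, by linarith, ?_⟩⟩
  intro S A B _ _ _ _ _ G H K nS nA nB hS hA hB adv nash hnash p hp0 hp1 ι β T
  have hι0 : 0 ≤ ι := ZeroSumMG.logFactor_nonneg nS nA nB K H hp0 hp1
  have hC : 0 ≤ 12 * c + 3 := by linarith
  refine ⟨?_, ?_⟩
  · have hRHS : 0 ≤ (12 * c + 3) *
        √((H : ℝ) ^ 3 * nS ^ 2 * ZeroSumMG.maxActionPairs A B H * T * ι) := by positivity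
    by_cases hN : 2 ≤ nS * nA * nB * (K * H)
    · simp only [T, ZeroSumMG.sqrt_regret_bound_eq]
      exact ZeroSumMG.regret_bound_of_two_le G nash adv hc hS hA hB hnash hp0 hp1 hN rfl
    · refine ZeroSumMG.ofReal_one_sub_le_toOuterMeasure _ (t := ∅) hp0.le (by simp)
        fun hist hne _ => le_trans ?_ hRHS
      by_cases hKH : K * H = 0
      · have h1 := ZeroSumMG.regret_le_length_mul G β nash hist
        rw [ZeroSumMG.length_of_historyLaw_ne_zero G β nash adv K hist hne, ← Nat.cast_mul, hKH,
          Nat.cast_zero] at h1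
        exact h1
      · have hH : 0 < H := Nat.pos_of_ne_zero (right_ne_zero_of_mul hKH)
        -- The adversary's distribution forces an initial state to exist, so the product is positive
        -- and therefore equal to `1`. Then each player has a single action and all policies have
        -- the same value.
        obtain ⟨s, -⟩ := (adv []).support_nonempty
        have : Nonempty (S 0) := ⟨s⟩
        have hS1 : 0 < nS := Fintype.card_pos.trans_le (hS 0 (Nat.zero_le H))
        have hA1 : 0 < nA := Fintype.card_pos.trans_le (hA 0 hH)
        have hB1 : 0 < nB := Fintype.card_pos.trans_le (hB 0 hH)
        have hpos : 0 < nS * nA * nB * (K * H) := by positivity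
        have h1 : nS * nA * nB * (K * H) = 1 := by omega
        simp only [mul_eq_one] at h1
        obtain ⟨⟨⟨-, rfl⟩, rfl⟩, -⟩ := h1
        exact (ZeroSumMG.regret_eq_zero_of_card_le_one G β nash hA hB hist).le
  · have hM : (ZeroSumMG.maxActionPairs A B H : ℝ) ≤ (nA : ℝ) * nB := by
      exact_mod_cast ZeroSumMG.maxActionPairs_le hA hB
    gcongr
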